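/- Let $\omega_1,\omega_2,\gamma,\varepsilon\in\mathbb C$, put $\delta=\omega_2/\omega_1$, and assume $\operatorname{Im}\delta>0$ and $0<\operatorname{Im}\gamma<\operatorname{Im}\delta$. Write $p=e^{2\pi i\delta}$, $q=e^{2\pi i\gamma}$. **Integral operator.** Let $\zeta(z)=\zeta(z;2\omega_1,2\omega_2)$ be the Weierstrass zeta function. For a function $f$ of period $1$ on $\mathbb R$ put $$(\mathsf Tf)(x)=\frac{i\omega_1}{\pi}\,\mathrm{PV}\!\!\int_{-1/2}^{1/2}\Big[\zeta(2\omega_1(y-x-\gamma))-2\zeta(2\omega_1(y-x))+\zeta(2\omega_1(y-x+\gamma))\Big]f(y)\,dy ,$$ where the principal value is the limit, as $r\to0^+$, of the integral over those $y\in[-1/2,1/2]$ whose distance to $x+\mathbb Z$ exceeds $r$. **Poisson structure.** The generators $\lambda_n$ ($n\in\mathbb Z\setminus\{0\}$) are the coordinate functions on the phase space $\ell^1(\mathbb Z\setminus\{0\})$ of complex sequences, with $$\{\lambda_n,\lambda_m\}=c_n\,\delta_{n+m,0},\qquad c_n=\frac{(1-q^n)(1-p^nq^{-n})}{1-p^n},$$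 and, for functions $F,G$ on the phase space, $\{F,G\}=\sum_{n\ne0}c_n\,\frac{\partial F}{\partial\lambda_n}\frac{\partial G}{\partial\lambda_{-n}}$ whenever this series converges. For real $x$ put $$\eta(x)=\varepsilon\exp\Big(\sum_{n\neq0}\lambda_ne^{-2\pi inx}\Big).$$ **Hamiltonians and densities.** Let $\vartheta_1(x)=-ip^{1/8}e^{\pi ix}\sum_{m\in\mathbb Z}(-1)^mp^{m(m+1)/2}e^{2\pi imx}$ with $p^{1/8}=e^{\pi i\delta/4}$, and $\vartheta_1'=\vartheta_1'(0)$. For $n\ge1$ put $$C_n=(-1)^{n-1}\frac{(\vartheta_1')^{n-1}\,\vartheta_1(n\gamma)}{(2\pi i)^{n-1}\,\vartheta_1(\gamma)^n},\qquad K_n(x_1,\dots,x_n)=\prod_{1\le i<j\le n}\frac{\vartheta_1(x_i-x_j)^2}{\vartheta_1(x_i-x_j+\gamma)\,\vartheta_1(x_i-x_j-\gamma)},$$ $$I_n=\frac{C_n}{n!}\int_{[-1/2,1/2]^n}K_n(x_1,\dots,x_n)\,\eta(x_1)\cdots\eta(x_n)\,dx_1\cdots dx_n,$$ $$H_n(x_1)=\frac{C_n}{(n-1)!}\int_{[-1/2,1/2]^{n-1}}K_n(x_1,\dots,x_n)\,\eta(x_1)\cdots\eta(x_n)\,dx_2\cdots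 dx_n .$$ **Proposition.** Let $n\ge1$. Then $n\,I_n=\int_{-1/2}^{1/2}H_n(x)\,dx$. The functions $I_n$ and $\eta(x)$ ($x\in\mathbb R$) are complex differentiable on the phase space. For every $x\in\mathbb R$ and at every point of the phase space the series for $\{I_n,\eta(x)\}$ and the principal value $(\mathsf TH_n)(x)$ converge, and $$\{I_n,\eta(x)\}=\eta(x)\,(\mathsf TH_n)(x).$$ Consequently, whenever a curve $t_n\mapsto\lambda(t_n)$ in the phase space is differentiable in the $\ell^1$ norm and moves along the Hamiltonian flow of $I_n$, that is, $d\lambda_k/dt_n=\{I_n,\lambda_k\}$ for all $k$, one has along it, for every real $x$, $$\frac{\partial\eta(x)}{\partial t_n}=\{I_n,\eta(x)\}=\eta(x)\,(\mathsf TH_n)(x).$$ For $n=1$ one has $H_1=\eta$, and $\eta(x,t_1)$ satisfies the integro-differential equation $\partial\eta/\partial t_1=\eta\cdot\mathsf T\eta$. -/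

import Mathlib

open scoped Topology

noncomputable section

namespace EllipticILW

/-! ### The singular integral operator -/

/-- The lattice point `2 m ω₁ + 2 n ω₂`. -/
def latticePoint (ω₁ ω₂ : ℂ) (mn : ℤ × ℤ) : ℂ := 2 * mn.1 * ω₁ + 2 * mn.2 * ω₂

/-- The Weierstrass zeta function `ζ(z; 2ω₁, 2ω₂)`. -/
def weierstrassZeta (ω₁ ω₂ z : ℂ) : ℂ :=
  1 / z + ∑' mn : {mn : ℤ × ℤ // mn ≠ 0},
    (1 / (z - latticePoint ω₁ ω₂ mn) + 1 / latticePoint ω₁ ω₂ mn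
      + z / latticePoint ω₁ ω₂ mn ^ 2)

/-- The discrete Laplacian `(Δ_γ f)(z) = f(z - γ) - 2 f(z) + f(z + γ)`. -/
def discreteLaplacian (γ : ℂ) (f : ℂ → ℂ) (z : ℂ) : ℂ := f (z - γ) - 2 * f z + f (z + γ)

/-- The kernel of the operator, as a function of `z = y - x`.  The discrete Laplacian acts in the
variable `z`, in which the periods are `1` and `δ = ω₂ / ω₁`. -/
def kernelT (ω₁ ω₂ γ z : ℂ) : ℂ :=
  discreteLaplacian γ (fun w => weierstrassZeta ω₁ ω₂ (2 * ω₁ * w)) z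

/-- The integral over the period `[-1/2, 1/2]` with the `r`-neighbourhood of the singular point
`y ≡ x mod 1` removed.  (`|s - round s|` is the distance from `s` to the nearest integer.) -/
def truncatedT (ω₁ ω₂ γ : ℂ) (f : ℝ → ℂ) (x r : ℝ) : ℂ :=
  Complex.I * ω₁ / Real.pi *
    ∫ y in {y : ℝ | y ∈ Set.Icc (-1 / 2) (1 / 2) ∧ r < |(y - x) - round (y - x)|},
      kernelT ω₁ ω₂ γ ((y - x : ℝ) : ℂ) * f y

/-- The principal value defining `(𝖳 f)(x)` exists. -/
def ConvergesT (ω₁ ω₂ γ : ℂ) (f : ℝ → ℂ) (x : ℝ) : Prop :=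
  ∃ v : ℂ, Filter.Tendsto (fun r => truncatedT ω₁ ω₂ γ f x r) (𝓝[>] 0) (𝓝 v)

/-- `(𝖳 f)(x) = (i ω₁ / π) PV ∫_{-1/2}^{1/2} (Δ_γ ζ)(2 ω₁ (y - x)) f(y) dy`. -/
def operatorT (ω₁ ω₂ γ : ℂ) (f : ℝ → ℂ) (x : ℝ) : ℂ :=
  Filter.limUnder (𝓝[>] 0) (fun r => truncatedT ω₁ ω₂ γ f x r)

/-- The integro-differential equation `∂u/∂t = u · 𝖳 u` holds for `u = u(x, t)` at `(x, t)`
(the principal value being convergent). -/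
def SatisfiesILWAt (ω₁ ω₂ γ : ℂ) (u : ℝ → ℝ → ℂ) (x t : ℝ) : Prop :=
  ConvergesT ω₁ ω₂ γ (fun y => u y t) x ∧
    HasDerivAt (fun s => u x s) (u x t * operatorT ω₁ ω₂ γ (fun y => u y t) x) t

/-! ### The Poisson structure -/

/-- The index set `ℤ \ {0}` of the generators. -/
abbrev Mode : Type := {n : ℤ // n ≠ 0}

/-- The involution `n ↦ -n`. -/
def Mode.opp (n : Mode) : Mode := ⟨-n.1, neg_ne_zero.mpr n.2⟩

/-- Phase space `ℓ¹(ℤ \ {0})`; the generators `λ_n` are its coordinate functions. -/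
abbrev Phase : Type := lp (fun _ : Mode => ℂ) 1

/-- The generator `λ_n`. -/
def coord (n : Mode) : Phase → ℂ := fun lam => lam n

/-- The partial derivative `∂F / ∂λ_n`. -/
def partialD (n : Mode) (F : Phase → ℂ) (lam : Phase) : ℂ :=
  fderiv ℂ F lam (lp.single 1 n (1 : ℂ))

/-- `c_n = (1 - q^n) (1 - p^n q^{-n}) / (1 - p^n)` with `q = e^{2πiγ}` and `p = e^{2πiδ}`. -/
def structureConst (δ γ : ℂ) (n : ℤ) : ℂ :=
  (1 - Complex.exp (2 * Real.pi * Complex.I * γ) ^ n) *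
      (1 - Complex.exp (2 * Real.pi * Complex.I * δ) ^ n *
        Complex.exp (2 * Real.pi * Complex.I * γ) ^ (-n)) /
    (1 - Complex.exp (2 * Real.pi * Complex.I * δ) ^ n)

/-- The general term of `{F, G} = ∑_n c_n (∂F/∂λ_n) (∂G/∂λ_{-n})`. -/
def bracketTerm (δ γ : ℂ) (F G : Phase → ℂ) (lam : Phase) (n : Mode) : ℂ :=
  structureConst δ γ n * partialD n F lam * partialD n.opp G lam

/-- The series for the bracket `{F, G}` converges (absolutely) at `lam`. -/
def BracketConverges (δ γ : ℂ) (F G : Phase → ℂ) (lam : Phase) : Prop :=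
  Summable (bracketTerm δ γ F G lam)

/-- The Poisson bracket, that is, the derivation in each argument with
`{λ_n, λ_m} = c_n δ_{n+m,0}` (see `bracket_coord`, `bracket_mul`, `bracket_antisymm`). -/
def bracket (δ γ : ℂ) (F G : Phase → ℂ) (lam : Phase) : ℂ :=
  ∑' n : Mode, bracketTerm δ γ F G lam n

theorem partialD_coord (n m : Mode) (lam : Phase) :
    partialD n (coord m) lam = if n = m then 1 else 0 := by
  have h : HasFDerivAt (coord m) (lp.evalCLM (p := 1) ℂ (fun _ : Mode => ℂ) m) lam :=
    (lp.evalCLM (p := 1) ℂ (fun _ : Mode => ℂ) m).hasFDerivAt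
  unfold partialD
  rw [h.fderiv]
  change (lp.single 1 n (1 : ℂ) : Phase) m = _
  by_cases hnm : n = m
  · subst hnm
    simp
  · rw [lp.single_apply_ne _ _ _ (Ne.symm hnm), if_neg hnm]

/-- The defining relation of the Poisson algebra. -/
theorem bracket_coord (δ γ : ℂ) (n m : Mode) (lam : Phase) :
    bracket δ γ (coord n) (coord m) lam =
      if (n : ℤ) + (m : ℤ) = 0 then structureConst δ γ n else 0 := by
  have hiff : n.opp = m ↔ (n : ℤ) + (m : ℤ) = 0 := by
    rw [Subtype.ext_iff]
    change -(n : ℤ) = m ↔ _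
    omega
  unfold bracket
  rw [tsum_eq_single n]
  · by_cases h : (n : ℤ) + (m : ℤ) = 0
    · simp [bracketTerm, partialD_coord, h, hiff.mpr h]
    · simp [bracketTerm, partialD_coord, h, mt hiff.mp h]
  · intro k hk
    simp [bracketTerm, partialD_coord, hk]

/-- The Leibniz rule. -/
theorem bracket_mul (δ γ : ℂ) (F G K : Phase → ℂ) (lam : Phase)
    (hG : DifferentiableAt ℂ G lam) (hK : DifferentiableAt ℂ K lam)
    (hFG : BracketConverges δ γ F G lam) (hFK : BracketConverges δ γ F K lam) :
    bracket δ γ F (fun l => G l * K l) lam =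
      G lam * bracket δ γ F K lam + K lam * bracket δ γ F G lam := by
  unfold bracket
  rw [← tsum_mul_left, ← tsum_mul_left, ← (hFK.mul_left _).tsum_add (hFG.mul_left _)]
  refine tsum_congr fun n => ?_
  have h : partialD n.opp (fun l => G l * K l) lam =
      G lam * partialD n.opp K lam + K lam * partialD n.opp G lam := by
    unfold partialD
    have := (hG.hasFDerivAt.mul hK.hasFDerivAt).fderiv
    change fderiv ℂ (fun l => G l * K l) lam = _ at this
    rw [this]
    simp
  simp only [bracketTerm, h]
  ring

/-- Antisymmetry. -/
theorem bracket_antisymm (δ γ : ℂ) (F G : Phase → ℂ) (lam : Phase) (hδ : 0 < δ.im) :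
    bracket δ γ F G lam = -bracket δ γ G F lam := by
  have hopp : Function.Involutive Mode.opp := fun n => by
    apply Subtype.ext
    change -(-(n : ℤ)) = n
    ring
  have hp1 : ∀ n : ℤ, n ≠ 0 → (1 - Complex.exp (2 * Real.pi * Complex.I * δ) ^ n) ≠ 0 := by
    intro n hn h0
    have h1 : ‖Complex.exp (2 * Real.pi * Complex.I * δ) ^ n‖ = 1 := by
      rw [← sub_eq_zero.mp h0]
      simp
    rw [← Complex.exp_int_mul, Complex.norm_exp, Real.exp_eq_one_iff] at h1
    simp [hn, Real.pi_ne_zero, hδ.ne'] at h1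
  have hc : ∀ n : Mode, structureConst δ γ n.opp = -structureConst δ γ n := by
    intro n
    have hp := hp1 n n.2
    have hp' := hp1 (-n) (neg_ne_zero.mpr n.2)
    unfold structureConst
    change (1 - Complex.exp (2 * Real.pi * Complex.I * γ) ^ (-(n : ℤ))) *
      (1 - Complex.exp (2 * Real.pi * Complex.I * δ) ^ (-(n : ℤ)) *
        Complex.exp (2 * Real.pi * Complex.I * γ) ^ (-(-(n : ℤ)))) /
      (1 - Complex.exp (2 * Real.pi * Complex.I * δ) ^ (-(n : ℤ))) = _
    rw [← neg_div, div_eq_div_iff hp' hp]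
    have hP := zpow_ne_zero (n : ℤ) (Complex.exp_ne_zero (2 * Real.pi * Complex.I * δ))
    have hQ := zpow_ne_zero (n : ℤ) (Complex.exp_ne_zero (2 * Real.pi * Complex.I * γ))
    simp only [neg_neg, zpow_neg]
    field_simp
    ring
  unfold bracket
  rw [← tsum_neg, ← (Equiv.tsum_eq hopp.toPerm)]
  refine tsum_congr fun n => ?_
  change bracketTerm δ γ F G lam n.opp = _
  simp only [bracketTerm, hc, hopp n]
  ring

/-- The curve `Λ` in phase space moves, at time `t`, along the Hamiltonian vector field of `F`:
`d λ_k / dt = {F, λ_k}` for all `k`. -/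
def IsHamiltonianFlowAt (δ γ : ℂ) (F : Phase → ℂ) (Λ : ℝ → Phase) (t : ℝ) : Prop :=
  ∃ v : Phase, HasDerivAt Λ v t ∧ ∀ k : Mode, v k = bracket δ γ F (coord k) (Λ t)

/-- `η(x) = ε exp (∑_{n ≠ 0} λ_n e^{-2πinx})`. -/
def eta (ε : ℂ) (lam : Phase) (x : ℝ) : ℂ :=
  ε * Complex.exp (∑' n : Mode, lam n * Complex.exp (-(2 * Real.pi * Complex.I * (n : ℤ) * x)))

/-! ### The Hamiltonians and their densities -/

/-- `ϑ₁(x; δ) = -i p^{1/8} e^{πix} ∑_m (-1)^m p^{m(m+1)/2} e^{2πimx}`, with `p = e^{2πiδ}` and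
`p^{1/8} = e^{πiδ/4}`. -/
def theta1 (δ x : ℂ) : ℂ :=
  -Complex.I * Complex.exp (Real.pi * Complex.I * δ / 4) * Complex.exp (Real.pi * Complex.I * x) *
    ∑' m : ℤ, (-1 : ℂ) ^ m *
      Complex.exp (Real.pi * Complex.I * δ * (m * (m + 1)) + 2 * Real.pi * Complex.I * m * x)

/-- The kernel `∏_{i<j} ϑ₁(x_i-x_j)² / (ϑ₁(x_i-x_j+γ) ϑ₁(x_i-x_j-γ))`. -/
def pairKernel (δ γ : ℂ) {n : ℕ} (x : Fin n → ℝ) : ℂ :=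
  ∏ i : Fin n, ∏ j ∈ Finset.Ioi i,
    theta1 δ (x i - x j) ^ 2 / (theta1 δ (x i - x j + γ) * theta1 δ (x i - x j - γ))

/-- The constant `(-1)^{n-1} (ϑ₁')^{n-1} ϑ₁(nγ) / ((2πi)^{n-1} ϑ₁(γ)^n)`, with `ϑ₁' = ϑ₁'(0)`;
only used for `n ≥ 1`. -/
def prefactor (δ γ : ℂ) (n : ℕ) : ℂ :=
  (-1) ^ (n - 1) * (deriv (theta1 δ) 0 ^ (n - 1) * theta1 δ (n * γ) /
    ((2 * Real.pi * Complex.I) ^ (n - 1) * theta1 δ γ ^ n))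

/-- The cube `[-1/2, 1/2]^n`. -/
def cube (n : ℕ) : Set (Fin n → ℝ) := Set.Icc (fun _ => -1 / 2) (fun _ => 1 / 2)

/-- The Hamiltonian `I_n` (for `n ≥ 1`), as a function on phase space. -/
def hamiltonian (δ γ ε : ℂ) (n : ℕ) (lam : Phase) : ℂ :=
  prefactor δ γ n / (n.factorial : ℂ) *
    ∫ x in cube n, pairKernel δ γ x * ∏ i : Fin n, eta ε lam (x i)

/-- The density `H_n(x₁)` (for `n ≥ 1`): an integral over the `n - 1` variables `x₂, …, x_n`. -/
def density (δ γ ε : ℂ) (n : ℕ) (lam : Phase) (x₁ : ℝ) : ℂ :=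
  match n with
  | 0 => 0
  | m + 1 =>
    prefactor δ γ (m + 1) / (m.factorial : ℂ) *
      ∫ y in cube m, pairKernel δ γ (Fin.cons x₁ y : Fin (m + 1) → ℝ) *
        ∏ i : Fin (m + 1), eta ε lam ((Fin.cons x₁ y : Fin (m + 1) → ℝ) i)

end EllipticILW

end

open EllipticILW

/-!
In the variable `z = y - x` the kernel of `𝖳` is `-i cot πz` plus a smooth periodic function, and
its Fourier expansion shows that `𝖳` acts on absolutely convergent Fourier series as the multiplier
`e^{2πikx} ↦ c_k e^{2πikx}`, where the `c_k` are exactly the structure constants of the bracket.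
On the other side `∂η(x)/∂λ_k = e^{-2πikx} η(x)`, and since the integrand of `I_n` is symmetric in
`x₁, …, x_n`, the derivative `∂I_n/∂λ_k` is the Fourier coefficient `ĥ_k` of `H_n`. Hence
`{I_n, η(x)}` and `η(x) (𝖳 H_n)(x)` are both equal to `η(x) ∑_k c_k ĥ_k e^{2πikx}`.

The density `H_n` has an absolutely convergent Fourier series because `ϑ₁` has no zeros off the
real axis in the strip `|Im x| < Im δ`, so that the pair kernel lies in the Wiener algebra of the
torus, which also contains the exponential `η`.
-/

noncomputable section

open Complex MeasureTheory Filter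

namespace EllipticILW

/-! ### Absolutely convergent Fourier series -/

/-- The character `x ↦ e^{2πikx}` of `ℝ / ℤ`, lifted to `ℝ`. -/
def mode (k : ℤ) (x : ℝ) : ℂ := exp (2 * Real.pi * I * k * x)

theorem mode_add_left (k l : ℤ) (x : ℝ) : mode (k + l) x = mode k x * mode l x := by
  simp only [mode, ← Complex.exp_add]
  congr 1
  push_cast
  ring

theorem mode_add_right (k : ℤ) (x y : ℝ) : mode k (x + y) = mode k x * mode k y := by
  simp only [mode, ← Complex.exp_add]
  congr 1
  push_cast
  ring

@[simp] theorem mode_zero_left (x : ℝ) : mode 0 x = 1 := by simp [mode]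

@[simp] theorem mode_zero_right (k : ℤ) : mode k 0 = 1 := by simp [mode]

@[simp] theorem norm_mode (k : ℤ) (x : ℝ) : ‖mode k x‖ = 1 := by
  simp [mode, Complex.norm_exp]

theorem mode_periodic (k : ℤ) : Function.Periodic (mode k) 1 := fun x ↦ by
  have h : mode k 1 = 1 := Complex.exp_eq_one_iff.mpr ⟨k, by push_cast; ring⟩
  rw [mode_add_right, h, mul_one]

theorem mode_neg_right (k : ℤ) (x : ℝ) : mode k (-x) = mode (-k) x := by
  simp [mode]

@[fun_prop] theorem continuous_mode (k : ℤ) : Continuous (mode k) := by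
  unfold mode
  fun_prop

theorem integral_mode (k : ℤ) :
    ∫ x in (-1 / 2 : ℝ)..(1 / 2), mode k x = if k = 0 then 1 else 0 := by
  split_ifs with hk
  · norm_num [hk]
  · have hc : (2 * Real.pi * I * k : ℂ) ≠ 0 := by simp [hk, Real.pi_ne_zero]
    have hper := mode_periodic k (-1 / 2)
    unfold mode
    rw [integral_exp_mul_complex hc, div_eq_zero_iff, sub_eq_zero]
    norm_num [mode] at hper ⊢
    exact .inl hper

theorem summable_mul_sub {a b : ℤ → ℂ} (ha : Summable a) (hb : Summable b) (k : ℤ) :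
    Summable fun m ↦ a m * b (k - m) :=
  (summable_mul_of_summable_norm ha.norm hb.norm).comp_injective (i := fun m ↦ (m, k - m))
    fun _ _ h ↦ (Prod.ext_iff.mp h).1

/-- `f` is the sum of the absolutely convergent Fourier series with coefficients `a`. -/
structure HasFourier (f : ℝ → ℂ) (a : ℤ → ℂ) : Prop where
  summable : Summable a
  hasSum : ∀ x, HasSum (fun k ↦ a k * mode k x) (f x)

namespace HasFourier

variable {f g : ℝ → ℂ} {a b : ℤ → ℂ}

theorem continuous (h : HasFourier f a) : Continuous f := by
  rw [funext fun x ↦ (h.hasSum x).tsum_eq.symm]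
  exact continuous_tsum (fun i ↦ by fun_prop) h.summable.norm fun i x ↦ by simp

theorem periodic (h : HasFourier f a) : Function.Periodic f 1 := fun x ↦ by
  refine (h.hasSum (x + 1)).unique ?_
  simpa only [mode_periodic _ x] using h.hasSum x

theorem norm_le (h : HasFourier f a) (x : ℝ) : ‖f x‖ ≤ ∑' k, ‖a k‖ := by
  rw [← (h.hasSum x).tsum_eq]
  simpa using norm_tsum_le_tsum_norm (f := fun k ↦ a k * mode k x) (by simpa using h.summable.norm)

theorem const_mul (h : HasFourier f a) (c : ℂ) :
    HasFourier (fun x ↦ c * f x) (fun k ↦ c * a k) :=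
  ⟨h.summable.mul_left c, fun x ↦ by simpa only [mul_assoc] using (h.hasSum x).mul_left c⟩

theorem mul (hf : HasFourier f a) (hg : HasFourier g b) :
    HasFourier (fun x ↦ f x * g x) (fun k ↦ ∑' m, a m * b (k - m)) := by
  let e : ℤ × ℤ ≃ ℤ × ℤ :=
    { toFun := fun q ↦ (q.2, q.1 - q.2)
      invFun := fun q ↦ (q.1 + q.2, q.1)
      left_inv := fun q ↦ by simp
      right_inv := fun q ↦ by simp }
  have hab : Summable fun q : ℤ × ℤ ↦ a q.2 * b (q.1 - q.2) := by
    have h := summable_mul_of_summable_norm hf.summable.norm hg.summable.norm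
    exact e.summable_iff.mpr h
  refine ⟨hab.prod, fun x ↦ ?_⟩
  have hs := summable_mul_of_summable_norm (f := fun k ↦ a k * mode k x)
    (g := fun k ↦ b k * mode k x) (by simpa using hf.summable.norm)
    (by simpa using hg.summable.norm)
  have hfg := e.hasSum_iff.mpr ((hf.hasSum x).mul (hg.hasSum x) hs)
  have hfg' : HasSum (fun q : ℤ × ℤ ↦ a q.2 * b (q.1 - q.2) * mode q.1 x) (f x * g x) := by
    refine hfg.congr_fun fun q ↦ ?_
    have hmode : mode q.1 x = mode q.2 x * mode (q.1 - q.2) x := by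
      rw [← mode_add_left, add_sub_cancel]
    simp only [Function.comp_apply, e, Equiv.coe_fn_mk, hmode]
    ring
  exact hfg'.prod_fiberwise fun k ↦
    (summable_mul_sub hf.summable hg.summable k).hasSum.mul_right (mode k x)

theorem integral_mul_mode (h : HasFourier f a) (l : ℤ) :
    ∫ x in (-1 / 2 : ℝ)..(1 / 2), f x * mode l x = a (-l) := by
  have hterm (k : ℤ) : ∫ x in (-1 / 2 : ℝ)..(1 / 2), a k * mode k x * mode l x =
      if k = -l then a (-l) else 0 := by
    simp only [mul_assoc, ← mode_add_left, intervalIntegral.integral_const_mul, integral_mode,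
      ← eq_neg_iff_add_eq_zero]
    split_ifs with hk <;> simp [hk]
  have hsum := intervalIntegral.hasSum_intervalIntegral_of_summable_norm
    (a := (-1 / 2 : ℝ)) (b := 1 / 2)
    (f := fun k ↦ (⟨fun x ↦ a k * mode k x * mode l x, by fun_prop⟩ : C(ℝ, ℂ)))
    (h.summable.norm.of_nonneg_of_le (fun _ ↦ norm_nonneg _) fun k ↦
      (ContinuousMap.norm_le _ (norm_nonneg (a k))).mpr fun x ↦ by simp)
  simp only [ContinuousMap.coe_mk, hterm, ((h.hasSum _).mul_right _).tsum_eq] at hsum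
  exact hsum.unique (hasSum_ite_eq (-l) (a (-l)))

end HasFourier

theorem exists_hasFourier_of_hasSum {ι : Type*} {f : ℝ → ℂ} (k : ι → ℤ) (a : ι → ℂ)
    (ha : Summable fun i ↦ ‖a i‖) (hf : ∀ x, HasSum (fun i ↦ a i * mode (k i) x) (f x)) :
    ∃ b, HasFourier f b := by
  have hs : Summable fun p : Σ l : ℤ, {i // k i = l} ↦ ‖a p.2‖ :=
    (Equiv.sigmaFiberEquiv k).summable_iff.mpr ha
  refine ⟨fun l ↦ ∑' i : {i // k i = l}, a i, hs.of_norm.sigma, fun x ↦ ?_⟩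
  have hfx : HasSum (fun p : Σ l : ℤ, {i // k i = l} ↦ a p.2 * mode (k p.2) x) (f x) :=
    (Equiv.sigmaFiberEquiv k).hasSum_iff.mpr (hf x)
  refine hfx.sigma fun l ↦ ?_
  have hl : Summable fun i : {i // k i = l} ↦ a i := (ha.subtype _).of_norm
  exact (hl.hasSum.mul_right (mode l x)).congr_fun fun i ↦ by rw [i.2]

section Smooth

variable {f : ℝ → ℂ}

theorem fourierCoeffOn_eq_of_periodic {f' : ℝ → ℂ} (hf : ∀ x, HasDerivAt f (f' x) x)
    (hf' : Continuous f') (hp : Function.Periodic f 1) {k : ℤ} (hk : k ≠ 0) :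
    fourierCoeffOn one_pos f k = (2 * Real.pi * I * k)⁻¹ * fourierCoeffOn one_pos f' k := by
  rw [fourierCoeffOn_of_hasDerivAt one_pos hk (fun x _ ↦ hf x) (hf'.intervalIntegrable _ _),
    show f 1 = f 0 by simpa using hp 0]
  push_cast
  have : (k : ℂ) ≠ 0 := by exact_mod_cast hk
  field_simp
  ring

theorem norm_fourierCoeffOn_le {B : ℝ} (hB : ∀ x ∈ Set.Icc (0 : ℝ) 1, ‖f x‖ ≤ B) (k : ℤ) :
    ‖fourierCoeffOn one_pos f k‖ ≤ B := by
  rw [fourierCoeffOn_eq_integral, sub_zero, div_one, one_smul]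
  refine (intervalIntegral.norm_integral_le_of_norm_le_const (C := B) fun x hx ↦ ?_).trans (by simp)
  rw [Set.uIoc_of_le zero_le_one] at hx
  rw [norm_smul, fourier_apply, Circle.norm_coe, one_mul]
  exact hB x ⟨hx.1.le, hx.2⟩

theorem summable_fourierCoeffOn_of_contDiff (hf : ContDiff ℝ 2 f) (hp : Function.Periodic f 1) :
    Summable (fourierCoeffOn one_pos f) := by
  have hf' : ContDiff ℝ 1 (deriv f) := ContDiff.deriv' (by simpa [one_add_one_eq_two] using hf)
  have hp' : Function.Periodic (deriv f) 1 := fun x ↦ by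
    rw [← deriv_comp_add_const, show (fun y ↦ f (y + 1)) = f from funext hp]
  have hf'' : Continuous (deriv (deriv f)) := hf'.continuous_deriv le_rfl
  obtain ⟨B, hB⟩ := (isCompact_Icc (a := (0 : ℝ)) (b := 1)).exists_bound_of_continuousOn
    hf''.continuousOn
  refine Summable.of_norm_bounded_eventually (g := fun k : ℤ ↦ B * (1 / (k : ℝ) ^ 2))
    ((Real.summable_one_div_int_pow.mpr one_lt_two).mul_left B) ?_
  filter_upwards [(Set.finite_singleton (0 : ℤ)).compl_mem_cofinite] with k hk
  rw [fourierCoeffOn_eq_of_periodic (fun x ↦ (hf.differentiable (by norm_num) x).hasDerivAt)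
      hf'.continuous hp hk,
    fourierCoeffOn_eq_of_periodic (fun x ↦ (hf'.differentiable (by norm_num) x).hasDerivAt)
      hf'' hp' hk, ← mul_assoc, norm_mul, mul_comm]
  refine mul_le_mul (norm_fourierCoeffOn_le hB k) ?_ (norm_nonneg _)
    ((norm_nonneg _).trans (hB 0 (by simp)))
  have hk0 : (0 : ℝ) < |(k : ℝ)| := abs_pos.mpr (by exact_mod_cast hk)
  have hle : |(k : ℝ)| ≤ 2 * Real.pi * |(k : ℝ)| := by nlinarith [Real.pi_gt_three]
  simp only [norm_mul, norm_inv, Complex.norm_ofNat, norm_real, norm_I, norm_intCast, mul_one,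
    Real.norm_eq_abs, abs_of_pos Real.pi_pos, ← mul_inv, one_div, ← sq_abs (k : ℝ), sq]
  gcongr

theorem exists_hasFourier_of_contDiff (hf : ContDiff ℝ 2 f) (hp : Function.Periodic f 1) :
    ∃ a, HasFourier f a := by
  have : Fact ((0 : ℝ) < 1) := ⟨one_pos⟩
  let F : C(AddCircle (1 : ℝ), ℂ) := ⟨hp.lift, continuous_coinduced_dom.mpr hf.continuous⟩
  have hcoeff : fourierCoeff F = fourierCoeffOn one_pos f := funext fun k ↦ by
    rw [fourierCoeff_eq_intervalIntegral _ _ 0, fourierCoeffOn_eq_integral]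
    simp [F, Function.Periodic.lift_coe]
  have hsum := summable_fourierCoeffOn_of_contDiff hf hp
  refine ⟨_, hsum, fun x ↦ ?_⟩
  have hx := has_pointwise_sum_fourier_series_of_summable (f := F) (hcoeff ▸ hsum) x
  rw [hcoeff] at hx
  simpa [F, mode] using hx

end Smooth

/-! ### Absolutely convergent Fourier series in several variables -/

section Wiener

variable {d : Type*} [Fintype d]

/-- The character `x ↦ e^{2πik·x}` of `ℝᵈ`. -/
def character (k : d → ℤ) (x : d → ℝ) : ℂ := ∏ j, mode (k j) (x j)

@[simp] theorem norm_character (k : d → ℤ) (x : d → ℝ) : ‖character k x‖ = 1 := by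
  simp [character, norm_prod]

theorem character_add (k l : d → ℤ) (x : d → ℝ) :
    character (k + l) x = character k x * character l x := by
  simp [character, mode_add_left, Finset.prod_mul_distrib]

theorem character_single [DecidableEq d] (i : d) (k : ℤ) (x : d → ℝ) :
    character (Pi.single i k) x = mode k (x i) := by
  rw [character, Finset.prod_eq_single i (fun j _ hj ↦ by simp [hj]) (by simp), Pi.single_eq_same]

theorem character_cons {m : ℕ} (k : Fin (m + 1) → ℤ) (x : ℝ) (y : Fin m → ℝ) :
    character k (Fin.cons x y : Fin (m + 1) → ℝ) = mode (k 0) x * character (Fin.tail k) y := by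
  simp [character, Fin.prod_univ_succ, Fin.tail]

@[fun_prop] theorem continuous_character (k : d → ℤ) : Continuous (character k) := by
  unfold character
  fun_prop

/-- `f` lies in the ball of radius `M` of the Wiener algebra: it is the sum of a Fourier series
whose coefficients have absolute values of sum at most `M`.  The terms are indexed by an arbitrary
countable family, in which frequencies may repeat, so that products need no convolution. -/
def WienerNormLE (M : ℝ) (f : (d → ℝ) → ℂ) : Prop :=
  ∃ (ι : Type) (_ : Countable ι) (k : ι → d → ℤ) (a : ι → ℂ),
    Summable (fun i ↦ ‖a i‖) ∧ ∑' i, ‖a i‖ ≤ M ∧ ∀ x, HasSum (fun i ↦ a i * character (k i) x) (f x)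

/-- The Wiener algebra of sums of absolutely convergent Fourier series on `ℝᵈ`. -/
def InWiener (f : (d → ℝ) → ℂ) : Prop := ∃ M, WienerNormLE M f

variable {M N : ℝ} {f g : (d → ℝ) → ℂ}

namespace WienerNormLE

theorem const (c : ℂ) : WienerNormLE ‖c‖ (fun _ : d → ℝ ↦ c) :=
  ⟨Unit, inferInstance, fun _ ↦ 0, fun _ ↦ c, (hasSum_unique _).summable, by simp, fun x ↦ by
    simp [character]⟩

theorem mul (hf : WienerNormLE M f) (hg : WienerNormLE N g) :
    WienerNormLE (M * N) (fun x ↦ f x * g x) := by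
  obtain ⟨ι, hι, k, a, ha, haM, hfa⟩ := hf
  obtain ⟨κ, hκ, l, b, hb, hbN, hgb⟩ := hg
  have hab : Summable fun p : ι × κ ↦ ‖a p.1 * b p.2‖ := Summable.mul_norm ha hb
  refine ⟨ι × κ, inferInstance, fun p ↦ k p.1 + l p.2, fun p ↦ a p.1 * b p.2, hab, ?_, fun x ↦ ?_⟩
  · calc ∑' p : ι × κ, ‖a p.1 * b p.2‖ = (∑' i, ‖a i‖) * ∑' j, ‖b j‖ := by
          simp only [norm_mul]
          exact (ha.tsum_mul_tsum hb (by simpa using hab)).symm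
      _ ≤ M * N := mul_le_mul haM hbN (tsum_nonneg fun _ ↦ norm_nonneg _)
          ((tsum_nonneg fun _ ↦ norm_nonneg _).trans haM)
  · refine ((hfa x).mul (hgb x) (.of_norm (hab.congr fun p ↦ by simp))).congr_fun fun p ↦ ?_
    rw [character_add, mul_mul_mul_comm]

theorem pow (hf : WienerNormLE M f) (N : ℕ) : WienerNormLE (M ^ N) (fun x ↦ f x ^ N) := by
  induction N with
  | zero => simpa using const (d := d) 1
  | succ N ih => simpa [pow_succ] using ih.mul hf

theorem inWiener_of_hasSum {M : ℕ → ℝ} {f : ℕ → (d → ℝ) → ℂ}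
    (hf : ∀ N, WienerNormLE (M N) (f N)) (hM : Summable M)
    (hg : ∀ x, HasSum (fun N ↦ f N x) (g x)) : InWiener g := by
  choose ι hι k a ha haM hfa using hf
  have hs : Summable fun p : Σ N, ι N ↦ ‖a p.1 p.2‖ := by
    rw [summable_sigma_of_nonneg fun _ ↦ norm_nonneg _]
    exact ⟨ha, hM.of_nonneg_of_le (fun N ↦ tsum_nonneg fun _ ↦ norm_nonneg _) haM⟩
  refine ⟨_, Σ N, ι N, inferInstance, fun p ↦ k p.1 p.2, fun p ↦ a p.1 p.2, hs, le_rfl,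
    fun x ↦ ?_⟩
  have hx : Summable fun p : Σ N, ι N ↦ a p.1 p.2 * character (k p.1 p.2) x :=
    .of_norm (hs.congr fun p ↦ by simp)
  exact (hg x).unique (hx.hasSum.sigma fun N ↦ hfa N x) ▸ hx.hasSum

end WienerNormLE

namespace InWiener

theorem const (c : ℂ) : InWiener (fun _ : d → ℝ ↦ c) := ⟨_, .const c⟩

theorem mul (hf : InWiener f) (hg : InWiener g) : InWiener (fun x ↦ f x * g x) :=
  ⟨_, hf.choose_spec.mul hg.choose_spec⟩

theorem prod {ι : Type*} (s : Finset ι) {f : ι → (d → ℝ) → ℂ} (hf : ∀ i ∈ s, InWiener (f i)) :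
    InWiener (fun x ↦ ∏ i ∈ s, f i x) := by
  classical
  induction s using Finset.induction_on with
  | empty => simpa using const 1
  | insert i s hi ih =>
    simp only [Finset.prod_insert hi]
    exact (hf i (by simp)).mul (ih fun j hj ↦ hf j (by simp [hj]))

theorem exp (hf : InWiener f) : InWiener (fun x ↦ Complex.exp (f x)) := by
  obtain ⟨M, hf⟩ := hf
  refine WienerNormLE.inWiener_of_hasSum (M := fun N ↦ ‖((N.factorial : ℂ))⁻¹‖ * M ^ N)
    (fun N ↦ (WienerNormLE.const ((N.factorial : ℂ))⁻¹).mul (hf.pow N)) ?_ fun x ↦ ?_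
  · exact (Real.summable_pow_div_factorial M).congr fun N ↦ by simp [div_eq_inv_mul]
  · rw [Complex.exp_eq_exp_ℂ]
    exact (NormedSpace.exp_series_hasSum_exp' (𝕂 := ℂ) (f x)).congr_fun fun N ↦ by simp

theorem continuous (hf : InWiener f) : Continuous f := by
  obtain ⟨_, ι, _, k, a, ha, -, h⟩ := hf
  rw [funext fun x ↦ (h x).tsum_eq.symm]
  exact continuous_tsum (fun i ↦ by fun_prop) ha fun i x ↦ by simp

theorem exists_hasFourier_integral_cons {m : ℕ} {f : (Fin (m + 1) → ℝ) → ℂ} (hf : InWiener f)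
    (μ : Measure (Fin m → ℝ)) [IsFiniteMeasure μ] :
    ∃ b, HasFourier (fun x ↦ ∫ y, f (Fin.cons x y : Fin (m + 1) → ℝ) ∂μ) b := by
  obtain ⟨M, ι, _, k, a, ha, -, h⟩ := hf
  have hint (l : Fin m → ℤ) : Integrable (character l) μ :=
    .of_bound (continuous_character l).aestronglyMeasurable 1 (.of_forall fun y ↦ by simp)
  refine exists_hasFourier_of_hasSum (fun i ↦ k i 0)
    (fun i ↦ a i * ∫ y, character (Fin.tail (k i)) y ∂μ) ?_ fun x ↦ ?_
  · refine (ha.mul_right (μ.real Set.univ)).of_nonneg_of_le (fun _ ↦ norm_nonneg _) fun i ↦ ?_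
    rw [norm_mul]
    gcongr
    simpa using norm_integral_le_of_norm_le_const (μ := μ) (C := 1)
      (.of_forall fun y ↦ (norm_character (Fin.tail (k i)) y).le)
  · have hsum := hasSum_integral_of_summable_integral_norm (μ := μ)
      (F := fun i y ↦ a i * (mode (k i 0) x * character (Fin.tail (k i)) y))
      (fun i ↦ ((hint _).const_mul _).const_mul _) (by simpa using ha.mul_left (μ.real Set.univ))
    simp only [← character_cons, (h _).tsum_eq] at hsum
    refine hsum.congr_fun fun i ↦ ?_
    simp only [character_cons, integral_const_mul]
    ring

end InWiener

namespace HasFourier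

variable {f : ℝ → ℂ} {a : ℤ → ℂ}

theorem inWiener_comp_apply (h : HasFourier f a) (i : d) : InWiener (fun x : d → ℝ ↦ f (x i)) := by
  classical
  exact ⟨_, ℤ, inferInstance, fun k ↦ Pi.single i k, a, h.summable.norm, le_rfl,
    fun x ↦ by simpa only [character_single] using h.hasSum (x i)⟩

theorem inWiener_comp_sub (h : HasFourier f a) (i j : d) :
    InWiener (fun x : d → ℝ ↦ f (x i - x j)) := by
  classical
  refine ⟨_, ℤ, inferInstance, fun k ↦ Pi.single i k + Pi.single j (-k), a, h.summable.norm, le_rfl,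
    fun x ↦ (h.hasSum (x i - x j)).congr_fun fun k ↦ ?_⟩
  rw [character_add, character_single, character_single, sub_eq_add_neg, mode_add_right,
    mode_neg_right]

end HasFourier

end Wiener

/-! ### Integration over the cube -/

instance isFiniteMeasure_restrict_cube (n : ℕ) :
    IsFiniteMeasure ((volume : Measure (Fin n → ℝ)).restrict (cube n)) :=
  ⟨by rw [Measure.restrict_apply_univ]; exact isCompact_Icc.measure_lt_top⟩

theorem measurableEquiv_piFinSuccAbove_zero_symm_apply {m : ℕ} (z : ℝ × (Fin m → ℝ)) :
    (MeasurableEquiv.piFinSuccAbove (fun _ : Fin (m + 1) ↦ ℝ) 0).symm z = Fin.cons z.1 z.2 := by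
  simp [MeasurableEquiv.piFinSuccAbove_symm_apply, Fin.insertNthEquiv]

theorem preimage_cons_cube (m : ℕ) :
    (fun z : ℝ × (Fin m → ℝ) ↦ (Fin.cons z.1 z.2 : Fin (m + 1) → ℝ)) ⁻¹' cube (m + 1) =
      Set.Icc (-1 / 2) (1 / 2) ×ˢ cube m := by
  ext z
  simp only [Set.mem_preimage, cube, Set.mem_Icc, Pi.le_def, Set.mem_prod, Fin.forall_fin_succ,
    Fin.cons_zero, Fin.cons_succ]
  tauto

theorem integral_cube_succ {E : Type*} [NormedAddCommGroup E] [NormedSpace ℝ E] {m : ℕ}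
    {f : (Fin (m + 1) → ℝ) → E} (hf : Continuous f) :
    ∫ z in cube (m + 1), f z =
      ∫ x in Set.Icc (-1 / 2 : ℝ) (1 / 2), ∫ y in cube m, f (Fin.cons x y : Fin (m + 1) → ℝ) := by
  have hpres := (volume_preserving_piFinSuccAbove (fun _ : Fin (m + 1) ↦ ℝ) 0).symm
  have hpreim := hpres.setIntegral_preimage_emb (MeasurableEquiv.measurableEmbedding _) f
    (cube (m + 1))
  rw [funext measurableEquiv_piFinSuccAbove_zero_symm_apply, preimage_cons_cube] at hpreim
  simp only at hpreim
  rw [← hpreim, Measure.volume_eq_prod, setIntegral_prod]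
  have hcons : Continuous fun z : ℝ × (Fin m → ℝ) ↦ (Fin.cons z.1 z.2 : Fin (m + 1) → ℝ) := by
    fun_prop
  exact (hf.comp hcons).continuousOn.integrableOn_compact (isCompact_Icc.prod isCompact_Icc)

/-! ### Lambert series -/

local notation "𝐞(" z ")" => exp (2 * Real.pi * I * z)

theorem norm_exp_two_pi_I_mul (z : ℂ) : ‖𝐞(z)‖ = Real.exp (-(2 * Real.pi * z.im)) := by
  simp [Complex.norm_exp]

theorem norm_exp_two_pi_I_mul_lt {z w : ℂ} (h : w.im < z.im) : ‖𝐞(z)‖ < ‖𝐞(w)‖ := by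
  rw [norm_exp_two_pi_I_mul, norm_exp_two_pi_I_mul, Real.exp_lt_exp]
  nlinarith [Real.pi_pos]

theorem norm_exp_two_pi_I_mul_lt_one {z : ℂ} (h : 0 < z.im) : ‖𝐞(z)‖ < 1 := by
  simpa using norm_exp_two_pi_I_mul_lt (w := 0) (z := z) (by simpa using h)

theorem one_sub_ne_zero_of_norm_lt_one {z : ℂ} (hz : ‖z‖ < 1) : 1 - z ≠ 0 := fun h ↦ by
  rw [← sub_eq_zero.mp h, norm_one] at hz
  exact hz.false

section Lambert

variable {p a w : ℂ}

theorem norm_pow_succ_lt_one (hp : ‖p‖ < 1) (k : ℕ) : ‖p ^ (k + 1)‖ < 1 := by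
  rw [norm_pow]
  exact pow_lt_one₀ (norm_nonneg p) hp k.succ_ne_zero

theorem hasSum_pow_succ (hp : ‖p‖ < 1) : HasSum (fun k : ℕ ↦ p ^ (k + 1)) (p / (1 - p)) := by
  simpa only [pow_succ, div_eq_inv_mul] using (hasSum_geometric_of_norm_lt_one hp).mul_right p

theorem summable_mul_pow_pow_succ (ha : ‖a‖ < 1) (hp : ‖p‖ < 1) :
    Summable fun q : ℕ × ℕ ↦ (a * p ^ q.1) ^ (q.2 + 1) := by
  have hbound := (summable_geometric_of_lt_one (norm_nonneg p) hp).mul_of_nonneg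
    ((summable_nat_add_iff 1).mpr (summable_geometric_of_lt_one (norm_nonneg a) ha))
    (fun _ ↦ by positivity) (fun _ ↦ by positivity)
  refine .of_norm_bounded hbound fun q ↦ ?_
  have hle : (‖p‖ ^ q.1) ^ (q.2 + 1) ≤ ‖p‖ ^ q.1 :=
    pow_le_of_le_one (by positivity) (pow_le_one₀ (norm_nonneg p) hp.le) q.2.succ_ne_zero
  rw [norm_pow, norm_mul, norm_pow, mul_pow, mul_comm]
  gcongr

theorem exists_hasSum_lambert (ha : ‖a‖ < 1) (hp : ‖p‖ < 1) :
    ∃ L, HasSum (fun n : ℕ ↦ a * p ^ n / (1 - a * p ^ n)) L ∧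
      HasSum (fun k : ℕ ↦ a ^ (k + 1) / (1 - p ^ (k + 1))) L := by
  have hsum := (summable_mul_pow_pow_succ ha hp).hasSum
  have hrow (n : ℕ) : HasSum (fun k : ℕ ↦ (a * p ^ n) ^ (k + 1))
      (a * p ^ n / (1 - a * p ^ n)) := by
    refine hasSum_pow_succ ?_
    rw [norm_mul, norm_pow]
    exact (mul_le_of_le_one_right (norm_nonneg a) (pow_le_one₀ (norm_nonneg p) hp.le)).trans_lt ha
  have hcol (k : ℕ) : HasSum (fun n : ℕ ↦ (a * p ^ n) ^ (k + 1))
      (a ^ (k + 1) / (1 - p ^ (k + 1))) := by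
    refine ((hasSum_geometric_of_norm_lt_one (norm_pow_succ_lt_one hp k)).mul_left
      (a ^ (k + 1))).congr_fun fun n ↦ ?_
    ring
  exact ⟨_, hsum.prod_fiberwise hrow,
    ((Equiv.prodComm ℕ ℕ).hasSum_iff.mpr hsum).prod_fiberwise hcol⟩

theorem one_sub_zpow_ne_zero (hp : ‖p‖ < 1) {n : ℤ} (hn : n ≠ 0) :
    1 - p ^ n ≠ 0 := fun h ↦ by
  have hnorm : ‖p‖ ^ n = 1 := by rw [← norm_zpow, ← sub_eq_zero.mp h, norm_one]
  exact hn ((zpow_eq_one_iff_right₀ (norm_nonneg p) hp.ne).mp hnorm)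

theorem summable_lambert_int (hw : ‖w‖ < 1) (hpw : ‖p‖ < ‖w‖) (hp0 : p ≠ 0) :
    Summable fun n : ℤ ↦ (1 - p ^ n)⁻¹ * w ^ n := by
  have hw0 : 0 < ‖w‖ := (norm_nonneg p).trans_lt hpw
  have hp : ‖p‖ < 1 := hpw.trans hw
  have hpw' : ‖p / w‖ < 1 := by rwa [norm_div, div_lt_one hw0]
  refine Summable.of_add_one_of_neg_add_one ?_ ?_
  · obtain ⟨_, -, h⟩ := exists_hasSum_lambert hw hp
    exact h.summable.congr fun k ↦ by rw [div_eq_inv_mul]; norm_cast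
  · obtain ⟨_, -, h⟩ := exists_hasSum_lambert hpw' hp
    refine h.summable.neg.congr fun k ↦ ?_
    have hk := one_sub_ne_zero_of_norm_lt_one (norm_pow_succ_lt_one hp k)
    have hk' : p ^ (k + 1) - 1 ≠ 0 := by rwa [← neg_sub, neg_ne_zero]
    have := norm_pos_iff.mp hw0
    rw [zpow_neg, zpow_neg]
    norm_cast
    rw [div_pow]
    field_simp
    ring

end Lambert

/-! ### The theta function -/

/-- The Laurent coefficient `(-1)^m p^{m(m+1)/2}` of the theta function. -/
def thetaCoeff (δ : ℂ) (m : ℤ) : ℂ := (-1) ^ m * exp (Real.pi * I * δ * (m * (m + 1)))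

@[simp] theorem thetaCoeff_zero (δ : ℂ) : thetaCoeff δ 0 = 1 := by simp [thetaCoeff]

theorem thetaCoeff_succ (δ : ℂ) (m : ℤ) :
    thetaCoeff δ (m + 1) = -(𝐞(δ) ^ (m + 1) * thetaCoeff δ m) := by
  have hexp : exp (Real.pi * I * δ * (((m + 1 : ℤ) : ℂ) * (((m + 1 : ℤ) : ℂ) + 1))) =
      𝐞(δ) ^ (m + 1) * exp (Real.pi * I * δ * (m * (m + 1))) := by
    rw [← Complex.exp_int_mul, ← Complex.exp_add]
    congr 1
    push_cast
    ring
  rw [thetaCoeff, thetaCoeff, hexp, zpow_add_one₀ (by norm_num)]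
  ring

theorem thetaCoeff_reflect (δ : ℂ) (m : ℤ) : thetaCoeff δ (-1 - m) = -thetaCoeff δ m := by
  have hsign : (-1 : ℂ) ^ (-1 - m) = -(-1) ^ m := by
    rw [zpow_sub₀ (by norm_num)]
    rcases Int.even_or_odd m with hm | hm <;> simp [hm.neg_one_zpow]
  rw [thetaCoeff, thetaCoeff, hsign, neg_mul]
  congr 3
  push_cast
  ring

theorem jacobiTheta₂_term_eq (δ x : ℂ) (m : ℤ) :
    jacobiTheta₂_term m (x + δ / 2 + 1 / 2) δ = thetaCoeff δ m * 𝐞(x) ^ m := by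
  rw [jacobiTheta₂_term, thetaCoeff, ← Complex.exp_int_mul, ← Complex.exp_pi_mul_I,
    ← Complex.exp_int_mul, ← Complex.exp_add, ← Complex.exp_add]
  congr 1
  ring

theorem theta1_eq_mul_tsum (δ x : ℂ) : theta1 δ x =
    -I * exp (Real.pi * I * δ / 4) * exp (Real.pi * I * x) * ∑' m, thetaCoeff δ m * 𝐞(x) ^ m := by
  rw [theta1]
  congr 1
  refine tsum_congr fun m ↦ ?_
  rw [thetaCoeff, ← Complex.exp_int_mul, mul_assoc ((-1 : ℂ) ^ m), ← Complex.exp_add]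
  congr 2
  ring_nf

theorem theta1_eq_mul_jacobiTheta₂ (δ x : ℂ) : theta1 δ x =
    -I * exp (Real.pi * I * δ / 4) * exp (Real.pi * I * x) *
      jacobiTheta₂ (x + δ / 2 + 1 / 2) δ := by
  rw [theta1_eq_mul_tsum, jacobiTheta₂]
  simp only [jacobiTheta₂_term_eq]

theorem theta1_add_one (δ x : ℂ) : theta1 δ (x + 1) = -theta1 δ x := by
  rw [theta1_eq_mul_jacobiTheta₂, theta1_eq_mul_jacobiTheta₂,
    show x + 1 + δ / 2 + 1 / 2 = (x + δ / 2 + 1 / 2) + 1 by ring, jacobiTheta₂_add_left, mul_add,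
    Complex.exp_add, mul_one, Complex.exp_pi_mul_I]
  ring

theorem theta1_neg (δ x : ℂ) : theta1 δ (-x) = -theta1 δ x := by
  have hx : exp (Real.pi * I * -x) = exp (Real.pi * I * x) * 𝐞(x) ^ (-1 : ℤ) := by
    rw [← Complex.exp_int_mul, ← Complex.exp_add]
    congr 1
    push_cast
    ring
  have hneg : 𝐞(-x) = 𝐞(x)⁻¹ := by rw [mul_neg, Complex.exp_neg]
  rw [theta1_eq_mul_tsum, theta1_eq_mul_tsum, ← (Equiv.subLeft (-1 : ℤ)).tsum_eq, hx, hneg]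
  simp only [Equiv.subLeft_apply, thetaCoeff_reflect, neg_mul, tsum_neg, inv_zpow', neg_sub,
    sub_neg_eq_add, zpow_add₀ (exp_ne_zero _), ← mul_assoc, tsum_mul_right]
  field_simp

theorem differentiable_theta1 {δ : ℂ} (hδ : 0 < δ.im) : Differentiable ℂ (theta1 δ) := by
  rw [show theta1 δ = _ from funext (theta1_eq_mul_jacobiTheta₂ δ)]
  have h : Differentiable ℂ fun x : ℂ ↦ jacobiTheta₂ (x + δ / 2 + 1 / 2) δ := fun x ↦
    (differentiableAt_jacobiTheta₂_fst (x + δ / 2 + 1 / 2) hδ).comp x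
      (f := fun x : ℂ ↦ x + δ / 2 + 1 / 2) (by fun_prop)
  fun_prop

/-! ### Nonvanishing of the theta function -/

theorem exp_two_pi_I_mul_add_ofReal_zpow (x : ℂ) (t : ℝ) (m : ℤ) :
    𝐞(x + t) ^ m = 𝐞(x) ^ m * mode m t := by
  rw [mul_add, Complex.exp_add, mul_zpow, mode, ← Complex.exp_int_mul _ m,
    ← Complex.exp_int_mul (2 * Real.pi * I * t) m]
  ring_nf

theorem hasFourier_jacobiTheta₂ {δ : ℂ} (hδ : 0 < δ.im) (x : ℂ) :
    HasFourier (fun t ↦ jacobiTheta₂ ((x + t) + δ / 2 + 1 / 2) δ)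
      (fun m ↦ thetaCoeff δ m * 𝐞(x) ^ m) where
  summable := ((summable_jacobiTheta₂_term_iff (x + δ / 2 + 1 / 2) δ).mpr hδ).congr
    (jacobiTheta₂_term_eq δ x)
  hasSum t := (hasSum_jacobiTheta₂_term ((x + t) + δ / 2 + 1 / 2) hδ).congr_fun fun m ↦ by
    rw [jacobiTheta₂_term_eq, exp_two_pi_I_mul_add_ofReal_zpow, mul_assoc]

theorem hasSum_thetaCoeff {δ : ℂ} (hδ : 0 < δ.im) : HasSum (thetaCoeff δ) 0 := by
  have hs : Summable (thetaCoeff δ) := by simpa using (hasFourier_jacobiTheta₂ hδ 0).summable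
  have hrefl := (Equiv.subLeft (-1 : ℤ)).tsum_eq (thetaCoeff δ)
  simp only [Equiv.subLeft_apply, thetaCoeff_reflect, tsum_neg] at hrefl
  exact neg_eq_self.mp hrefl ▸ hs.hasSum

section Convolution

variable {δ : ℂ} {s : ℤ → ℂ}

theorem thetaCoeff_convolution_succ (hδ : 0 < δ.im)
    (hs : ∀ N, HasSum (fun m ↦ thetaCoeff δ m * (1 - 𝐞(δ) ^ (N - m))⁻¹) (s N)) (N : ℤ) :
    s (N + 1) = 𝐞(δ) ^ (N + 1) * (thetaCoeff δ N - s N) := by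
  have hshift := (Equiv.addRight (1 : ℤ)).hasSum_iff.mpr (hs (N + 1))
  have hzero := (Equiv.addRight (1 : ℤ)).hasSum_iff.mpr (hasSum_thetaCoeff hδ)
  have hsum := (hzero.sub ((hs N).mul_left (𝐞(δ) ^ (N + 1)))).add
    (hasSum_ite_eq N (𝐞(δ) ^ (N + 1) * thetaCoeff δ N))
  refine (hshift.unique (hsum.congr_fun fun m ↦ ?_)).trans (by ring)
  simp only [Function.comp_apply, Equiv.coe_addRight, thetaCoeff_succ δ m]
  rw [show N + 1 - (m + 1) = N - m by ring]
  split_ifs with hm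
  · subst hm
    simp
  · have hne := one_sub_zpow_ne_zero (norm_exp_two_pi_I_mul_lt_one hδ) (n := N - m) (by omega)
    have hpow : 𝐞(δ) ^ (m + 1) * 𝐞(δ) ^ (N - m) = 𝐞(δ) ^ (N + 1) := by
      rw [← zpow_add₀ (exp_ne_zero _)]
      ring_nf
    rw [← hpow]
    field_simp
    ring

theorem thetaCoeff_convolution (hδ : 0 < δ.im)
    (hs : ∀ N, HasSum (fun m ↦ thetaCoeff δ m * (1 - 𝐞(δ) ^ (N - m))⁻¹) (s N)) (N : ℤ) :
    s N = thetaCoeff δ N * (s 0 - N) := by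
  have hsucc := thetaCoeff_convolution_succ hδ hs
  induction N using Int.induction_on with
  | zero => simp
  | succ i ih =>
    rw [hsucc, ih, thetaCoeff_succ]
    push_cast
    ring
  | pred i ih =>
    have hs' := hsucc (-(i : ℤ) - 1)
    have ht' := thetaCoeff_succ δ (-(i : ℤ) - 1)
    rw [sub_add_cancel] at hs' ht'
    rw [ih, ht', neg_mul, mul_assoc, ← mul_neg,
      mul_right_inj' (zpow_ne_zero _ (exp_ne_zero _))] at hs'
    push_cast at hs' ⊢
    linear_combination hs'

theorem summable_thetaCoeff_mul_lambert {x : ℂ} (hx : 0 < x.im) (hxδ : x.im < δ.im) (N : ℤ) :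
    Summable fun m ↦ thetaCoeff δ m * (1 - 𝐞(δ) ^ (N - m))⁻¹ := by
  have hΛ := summable_lambert_int (norm_exp_two_pi_I_mul_lt_one hx)
    (norm_exp_two_pi_I_mul_lt hxδ) (exp_ne_zero _)
  have hconv := summable_mul_sub (hasFourier_jacobiTheta₂ (hx.trans hxδ) x).summable hΛ N
  refine (summable_mul_right_iff (zpow_ne_zero N (exp_ne_zero (2 * Real.pi * I * x)))).mp
    (hconv.congr fun m ↦ ?_)
  rw [zpow_sub₀ (exp_ne_zero (2 * Real.pi * I * x))]
  field_simp

end Convolution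

/-- Multiplying the theta series by the Lambert series `∑ wⁿ / (1 - pⁿ)` turns its coefficients
`t_N` into `t_N (s - N)`: up to an additive constant, the Lambert series is the logarithmic
derivative of theta. -/
theorem exists_jacobiTheta₂'_eq_mul {δ x : ℂ} (hx : 0 < x.im) (hxδ : x.im < δ.im) :
    ∃ (M : ℝ → ℂ) (B : ℝ), ∀ t : ℝ, ‖M t‖ ≤ B ∧ jacobiTheta₂' ((x + t) + δ / 2 + 1 / 2) δ =
      M t * jacobiTheta₂ ((x + t) + δ / 2 + 1 / 2) δ := by
  have hδ := hx.trans hxδ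
  have hΛs := summable_lambert_int (norm_exp_two_pi_I_mul_lt_one hx) (norm_exp_two_pi_I_mul_lt hxδ)
    (exp_ne_zero _)
  obtain ⟨Λ, hΛ⟩ : ∃ Λ, HasFourier Λ fun n ↦ (1 - 𝐞(δ) ^ n)⁻¹ * 𝐞(x) ^ n :=
    ⟨_, hΛs, fun t ↦ (Summable.of_norm (by simpa using hΛs.norm)).hasSum⟩
  have hΘ := hasFourier_jacobiTheta₂ hδ x
  set s : ℤ → ℂ := fun N ↦ ∑' m, thetaCoeff δ m * (1 - 𝐞(δ) ^ (N - m))⁻¹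
  have hs (N : ℤ) : HasSum (fun m ↦ thetaCoeff δ m * (1 - 𝐞(δ) ^ (N - m))⁻¹) (s N) :=
    (summable_thetaCoeff_mul_lambert hx hxδ N).hasSum
  have hcoeff (N : ℤ) : ∑' m, thetaCoeff δ m * 𝐞(x) ^ m *
      ((1 - 𝐞(δ) ^ (N - m))⁻¹ * 𝐞(x) ^ (N - m)) = thetaCoeff δ N * (s 0 - N) * 𝐞(x) ^ N := by
    rw [← thetaCoeff_convolution hδ hs N]
    refine (((hs N).mul_right (𝐞(x) ^ N)).congr_fun fun m ↦ ?_).tsum_eq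
    rw [zpow_sub₀ (exp_ne_zero (2 * Real.pi * I * x))]
    field_simp
  refine ⟨fun t ↦ 2 * Real.pi * I * (s 0 - Λ t),
    2 * Real.pi * (‖s 0‖ + ∑' n : ℤ, ‖(1 - 𝐞(δ) ^ n)⁻¹ * 𝐞(x) ^ n‖), fun t ↦ ⟨?_, ?_⟩⟩
  · rw [norm_mul]
    gcongr
    · simp [abs_of_pos Real.pi_pos]
    · exact (norm_sub_le _ _).trans (by gcongr; exact hΛ.norm_le t)
  · have hprod := ((hΘ.mul hΛ).hasSum t).mul_left (2 * Real.pi * I)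
    have hderiv := ((hΘ.hasSum t).mul_left (2 * Real.pi * I * s 0)).sub hprod
    refine ((hasSum_jacobiTheta₂'_term _ hδ).unique (hderiv.congr_fun fun N ↦ ?_)).trans (by ring)
    have hterm : jacobiTheta₂'_term N ((x + t) + δ / 2 + 1 / 2) δ =
      2 * Real.pi * I * N * jacobiTheta₂_term N ((x + t) + δ / 2 + 1 / 2) δ := rfl
    rw [hcoeff, hterm, jacobiTheta₂_term_eq, exp_two_pi_I_mul_add_ofReal_zpow]
    ring

theorem jacobiTheta₂_ne_zero {δ x : ℂ} (hx : 0 < x.im) (hxδ : x.im < δ.im) :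
    jacobiTheta₂ (x + δ / 2 + 1 / 2) δ ≠ 0 := by
  intro h0
  have hδ := hx.trans hxδ
  obtain ⟨M, B, hMB⟩ := exists_jacobiTheta₂'_eq_mul hx hxδ
  set f : ℝ → ℂ := fun t ↦ jacobiTheta₂ ((x + t) + δ / 2 + 1 / 2) δ with hf
  have hd (t : ℝ) : HasDerivAt f (M t * f t) t := by
    have hline : HasDerivAt (fun t : ℝ ↦ (x + t) + δ / 2 + 1 / 2) 1 t := by
      simpa using ((((Complex.ofRealCLM.hasDerivAt (x := t)).const_add x).add_const
        (δ / 2)).add_const (1 / 2))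
    have htheta := (hasDerivAt_jacobiTheta₂_fst ((x + t) + δ / 2 + 1 / 2) hδ).comp t hline
    rwa [(hMB t).2, mul_one] at htheta
  have hB : 0 ≤ B := (norm_nonneg _).trans (hMB 0).1
  have hzero : f = fun _ ↦ 0 := by
    refine ODE_solution_unique_univ (v := fun t y ↦ M t * y) (s := fun _ ↦ Set.univ)
      (K := ⟨B, hB⟩) (t₀ := 0) (fun t ↦ ?_) (fun t ↦ ⟨hd t, trivial⟩)
      (fun t ↦ ⟨by simpa using hasDerivAt_const t (0 : ℂ), trivial⟩) (by simpa [hf] using h0)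
    refine (LipschitzWith.of_dist_le_mul fun y z ↦ ?_).lipschitzOnWith
    rw [dist_eq_norm, dist_eq_norm, ← mul_sub, norm_mul]
    exact mul_le_mul_of_nonneg_right (hMB t).1 (norm_nonneg _)
  have hfourier : HasFourier f fun m ↦ thetaCoeff δ m * 𝐞(x) ^ m := hasFourier_jacobiTheta₂ hδ x
  have hcoeff := hfourier.integral_mul_mode 0
  simp [hzero] at hcoeff

theorem theta1_ne_zero {δ x : ℂ} (hx : 0 < x.im) (hxδ : x.im < δ.im) : theta1 δ x ≠ 0 := by
  rw [theta1_eq_mul_jacobiTheta₂]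
  exact mul_ne_zero (mul_ne_zero (mul_ne_zero (neg_ne_zero.mpr I_ne_zero) (exp_ne_zero _))
    (exp_ne_zero _)) (jacobiTheta₂_ne_zero hx hxδ)

/-! ### The pair kernel -/

/-- The factor `ϑ₁(x)² / (ϑ₁(x + γ) ϑ₁(x - γ))` of the kernel `K_n`. -/
def pairFactor (δ γ : ℂ) (x : ℝ) : ℂ := theta1 δ x ^ 2 / (theta1 δ (x + γ) * theta1 δ (x - γ))

theorem pairFactor_neg (δ γ : ℂ) (x : ℝ) : pairFactor δ γ (-x) = pairFactor δ γ x := by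
  rw [pairFactor, pairFactor, Complex.ofReal_neg, show -(x : ℂ) + γ = -(x - γ) by ring,
    show -(x : ℂ) - γ = -(x + γ) by ring, theta1_neg, theta1_neg, theta1_neg]
  ring

theorem pairFactor_periodic (δ γ : ℂ) : Function.Periodic (pairFactor δ γ) 1 := fun x ↦ by
  rw [pairFactor, pairFactor, Complex.ofReal_add, Complex.ofReal_one, add_right_comm,
    add_sub_right_comm, theta1_add_one, theta1_add_one, theta1_add_one]
  ring

theorem contDiff_pairFactor {δ γ : ℂ} (hγ : 0 < γ.im) (hγδ : γ.im < δ.im) :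
    ContDiff ℝ 2 (pairFactor δ γ) := by
  have htheta : ContDiff ℝ 2 (theta1 δ) :=
    (differentiable_theta1 (hγ.trans hγδ)).contDiff.restrict_scalars ℝ
  have hx : ContDiff ℝ 2 fun x : ℝ ↦ (x : ℂ) := Complex.ofRealCLM.contDiff
  have hadd (x : ℝ) : theta1 δ (x + γ) ≠ 0 :=
    theta1_ne_zero (by simpa using hγ) (by simpa using hγδ)
  have hsub (x : ℝ) : theta1 δ (x - γ) ≠ 0 := by
    rw [← neg_sub, theta1_neg, neg_ne_zero]
    exact theta1_ne_zero (by simpa using hγ) (by simpa using hγδ)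
  unfold pairFactor
  simp only [div_eq_mul_inv]
  exact ((htheta.comp hx).pow 2).mul (((htheta.comp (hx.add contDiff_const)).mul
    (htheta.comp (hx.sub contDiff_const))).inv fun x ↦ mul_ne_zero (hadd x) (hsub x))

theorem pairKernel_eq {δ γ : ℂ} {n : ℕ} (x : Fin n → ℝ) :
    pairKernel δ γ x = ∏ i : Fin n, ∏ j ∈ Finset.Ioi i, pairFactor δ γ (x i - x j) := by
  simp [pairKernel, pairFactor]

theorem inWiener_pairKernel {δ γ : ℂ} (hγ : 0 < γ.im) (hγδ : γ.im < δ.im) (n : ℕ) :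
    InWiener fun x : Fin n → ℝ ↦ pairKernel δ γ x := by
  obtain ⟨a, ha⟩ := exists_hasFourier_of_contDiff (contDiff_pairFactor hγ hγδ)
    (pairFactor_periodic δ γ)
  simp only [pairKernel_eq]
  exact .prod _ fun i _ ↦ .prod _ fun j _ ↦ ha.inWiener_comp_sub i j

/-- Both products run over the two-element subsets of `Fin n`; Mathlib has the antisymmetric case,
to which this is reduced by inserting the sign of `j - i`. -/
theorem prod_Ioi_comp_perm {R : Type*} [CommRing R] {n : ℕ} (σ : Equiv.Perm (Fin n))
    {f : Fin n → Fin n → R} (hf : ∀ i j, f i j = f j i) :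
    ∏ i, ∏ j ∈ Finset.Ioi i, f (σ i) (σ j) = ∏ i, ∏ j ∈ Finset.Ioi i, f i j := by
  let g : Fin n → Fin n → R := fun i j ↦ if i < j then 1 else if j < i then -1 else 0
  have hg (i j : Fin n) : g i j = -g j i := by
    rcases lt_trichotomy i j with h | h | h
    · simp [g, h, h.not_gt]
    · simp [g, h]
    · simp [g, h, h.not_gt]
  have hfg := σ.prod_Ioi_comp_eq_sign_mul_prod (f := fun i j ↦ f i j * g i j) fun i j ↦ by
    rw [hg, hf, mul_neg]
  have hg_perm := σ.prod_Ioi_comp_eq_sign_mul_prod hg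
  have hg_one : ∏ i, ∏ j ∈ Finset.Ioi i, g i j = 1 :=
    Finset.prod_eq_one fun i _ ↦ Finset.prod_eq_one fun j hj ↦ by
      simp [g, Finset.mem_Ioi.mp hj]
  simp only [Finset.prod_mul_distrib] at hfg
  rw [hg_perm, hg_one, mul_one, mul_one, mul_comm] at hfg
  exact ((Equiv.Perm.sign σ).isUnit.map (Int.castRingHom R)).mul_left_cancel hfg

theorem pairKernel_comp_perm {δ γ : ℂ} {n : ℕ} (σ : Equiv.Perm (Fin n)) (x : Fin n → ℝ) :
    pairKernel δ γ (fun i ↦ x (σ i)) = pairKernel δ γ x := by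
  rw [pairKernel_eq, pairKernel_eq]
  refine prod_Ioi_comp_perm σ (f := fun i j ↦ pairFactor δ γ (x i - x j)) fun i j ↦ ?_
  rw [← pairFactor_neg, neg_sub]

/-! ### The kernel of the singular integral operator -/

theorem hasSum_int_iff_hasSum_pairs {f : ℤ → ℂ} (hf : Summable f) {b : ℂ} :
    HasSum f (f 0 + b) ↔ HasSum (fun n : ℕ ↦ f (n + 1) + f (-(n + 1))) b := by
  have hpairs := (hasSum_nat_add_iff' 1).mpr hf.hasSum.nat_add_neg
  simp only [Finset.sum_range_one, Nat.cast_add, Nat.cast_one, Nat.cast_zero, neg_zero,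
    add_sub_add_right_eq_sub] at hpairs
  refine ⟨fun h ↦ ?_, fun h ↦ ?_⟩
  · rwa [h.tsum_eq, add_sub_cancel_left] at hpairs
  · rw [← hpairs.unique h, add_sub_cancel]
    exact hf.hasSum

/-- The function `π cot(πz)`, which is the sum of `1 / (z - n)` over the integers `n`. -/
def cotPi (z : ℂ) : ℂ := Real.pi * cot (Real.pi * z)

theorem cotPi_neg (z : ℂ) : cotPi (-z) = -cotPi z := by
  simp [cotPi, Complex.cot, div_neg]

theorem hasSum_cotPi {z : ℂ} (hz : ∀ n : ℤ, z ≠ n) :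
    HasSum (fun n : ℕ ↦ 1 / (z - (n + 1)) + 1 / (z + (n + 1))) (cotPi z - 1 / z) := by
  have hz' : z ∈ integerComplement := fun ⟨n, hn⟩ ↦ hz n hn.symm
  rw [cotPi, cot_series_rep' hz']
  exact (summable_cotTerm hz').hasSum

theorem discreteLaplacian_cotPi_neg (γ z : ℂ) :
    discreteLaplacian γ cotPi (-z) = -discreteLaplacian γ cotPi z := by
  rw [discreteLaplacian, discreteLaplacian, show -z - γ = -(z + γ) by ring,
    show -z + γ = -(z - γ) by ring, cotPi_neg, cotPi_neg, cotPi_neg]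
  ring

theorem hasSum_discreteLaplacian_cotPi {γ z : ℂ} (hz : ∀ n : ℤ, z ≠ n)
    (hsub : ∀ n : ℤ, z - γ ≠ n) (hadd : ∀ n : ℤ, z + γ ≠ n)
    (hs : Summable fun m : ℤ ↦ discreteLaplacian γ (fun w ↦ 1 / (w - m)) z) :
    HasSum (fun m : ℤ ↦ discreteLaplacian γ (fun w ↦ 1 / (w - m)) z)
      (discreteLaplacian γ cotPi z) := by
  have hpairs := ((hasSum_cotPi hsub).sub ((hasSum_cotPi hz).mul_left 2)).add (hasSum_cotPi hadd)
  have hint := (hasSum_int_iff_hasSum_pairs hs).mpr (hpairs.congr_fun fun n ↦ by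
    simp only [discreteLaplacian]
    push_cast
    ring)
  convert hint using 1
  simp only [discreteLaplacian]
  push_cast
  ring

/-- The lattice point `m + nδ`, so that `2 ω₁ (m + nδ) = 2 m ω₁ + 2 n ω₂`. -/
def normLattice (δ : ℂ) (mn : ℤ × ℤ) : ℂ := mn.1 + mn.2 * δ

section Lattice

variable {ω₁ ω₂ δ γ : ℂ}

theorem normLattice_ne_zero (hδ : 0 < δ.im) {mn : ℤ × ℤ} (h : mn ≠ 0) :
    normLattice δ mn ≠ 0 := fun h0 ↦ by
  have him := congrArg Complex.im h0
  simp only [normLattice, add_im, intCast_im, mul_im, intCast_re, zero_im, zero_mul, zero_add,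
    add_zero, mul_eq_zero, Int.cast_eq_zero, hδ.ne', or_false] at him
  have hre : mn.1 = 0 := by simpa [normLattice, him] using congrArg Complex.re h0
  exact h (Prod.ext hre him)

theorem summable_norm_normLattice_inv_cube (hδ : 0 < δ.im) :
    Summable fun mn : ℤ × ℤ ↦ ‖(normLattice δ mn)⁻¹‖ ^ 3 := by
  have h := EisensteinSeries.summable_norm_eisSummand (k := 3) le_rfl ⟨δ, hδ⟩
  let e : ℤ × ℤ ≃ (Fin 2 → ℤ) := (Equiv.prodComm ℤ ℤ).trans (finTwoArrowEquiv ℤ).symm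
  refine (e.summable_iff.mpr h).congr fun mn ↦ ?_
  simp only [Function.comp_apply, EisensteinSeries.eisSummand, normLattice, e, Equiv.trans_apply,
    Equiv.prodComm_apply, finTwoArrowEquiv_symm_apply, Prod.fst_swap, Prod.snd_swap,
    Matrix.cons_val_zero, Matrix.cons_val_one]
  rw [zpow_neg, norm_inv, norm_inv, inv_pow, add_comm, norm_zpow]
  norm_cast

theorem norm_zeta_term_le {w l : ℂ} (hl : l ≠ 0) (hwl : 2 * ‖w‖ < ‖l‖) :
    ‖1 / (w - l) + 1 / l + w / l ^ 2‖ ≤ 2 * ‖w‖ ^ 2 * ‖l⁻¹‖ ^ 3 := by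
  have hl0 : 0 < ‖l‖ := norm_pos_iff.mpr hl
  have hsub : ‖l‖ / 2 ≤ ‖w - l‖ := by
    have := norm_sub_norm_le l w
    rw [norm_sub_rev] at this
    linarith
  have hne : w - l ≠ 0 := norm_pos_iff.mp (by linarith)
  have hterm : 1 / (w - l) + 1 / l + w / l ^ 2 = w ^ 2 * l⁻¹ ^ 2 * (w - l)⁻¹ := by
    field_simp
    ring
  rw [hterm, norm_mul, norm_mul, norm_pow, norm_pow, norm_inv, norm_inv]
  calc ‖w‖ ^ 2 * ‖l‖⁻¹ ^ 2 * ‖w - l‖⁻¹ ≤ ‖w‖ ^ 2 * ‖l‖⁻¹ ^ 2 * (‖l‖ / 2)⁻¹ := by gcongr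
    _ = 2 * ‖w‖ ^ 2 * ‖l‖⁻¹ ^ 3 := by
      rw [inv_div]
      field_simp

theorem summable_zeta_terms (hδ : 0 < δ.im) (w : ℂ) :
    Summable fun mn : {mn : ℤ × ℤ // mn ≠ 0} ↦ 1 / (w - normLattice δ mn) +
      1 / normLattice δ mn + w / normLattice δ mn ^ 2 := by
  have hs : Summable fun mn : {mn : ℤ × ℤ // mn ≠ 0} ↦ ‖(normLattice δ mn)⁻¹‖ ^ 3 :=
    (summable_norm_normLattice_inv_cube hδ).subtype _
  have hpos : (0 : ℝ) < (2 * ‖w‖ + 1)⁻¹ ^ 3 := by positivity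
  refine Summable.of_norm_bounded_eventually (hs.mul_left (2 * ‖w‖ ^ 2)) ?_
  filter_upwards [hs.tendsto_cofinite_zero.eventually (gt_mem_nhds hpos)] with mn hmn
  have hl := normLattice_ne_zero hδ mn.2
  refine norm_zeta_term_le hl ?_
  have hinv := lt_of_pow_lt_pow_left₀ 3 (by positivity) hmn
  rw [norm_inv, inv_lt_inv₀ (norm_pos_iff.mpr hl) (by positivity)] at hinv
  linarith

theorem hasSum_weierstrassZeta (hδ : δ = ω₂ / ω₁) (hδ_pos : 0 < δ.im) (w : ℂ) :
    HasSum (fun mn : {mn : ℤ × ℤ // mn ≠ 0} ↦ 1 / (w - normLattice δ mn) +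
      1 / normLattice δ mn + w / normLattice δ mn ^ 2)
      (2 * ω₁ * weierstrassZeta ω₁ ω₂ (2 * ω₁ * w) - 1 / w) := by
  have hω : ω₁ ≠ 0 := fun h ↦ by simp [hδ, h] at hδ_pos
  have hω₂ : ω₂ = δ * ω₁ := by rw [hδ, div_mul_cancel₀ _ hω]
  have hlattice (mn : ℤ × ℤ) : latticePoint ω₁ ω₂ mn = 2 * ω₁ * normLattice δ mn := by
    rw [latticePoint, normLattice, hω₂]
    ring
  have hzeta : 2 * ω₁ * weierstrassZeta ω₁ ω₂ (2 * ω₁ * w) - 1 / w =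
      ∑' mn : {mn : ℤ × ℤ // mn ≠ 0}, (1 / (w - normLattice δ mn) +
      1 / normLattice δ mn + w / normLattice δ mn ^ 2) := by
    rw [weierstrassZeta, mul_add, ← tsum_mul_left, show 2 * ω₁ * (1 / (2 * ω₁ * w)) = 1 / w by
      field_simp, add_sub_cancel_left]
    refine tsum_congr fun mn ↦ ?_
    have hn := normLattice_ne_zero hδ_pos mn.2
    rw [hlattice, ← mul_sub]
    rcases eq_or_ne (w - normLattice δ mn) 0 with hv | hv
    · rw [hv]
      simp only [mul_zero, div_zero, zero_add]
      field_simp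
    · field_simp
  rw [hzeta]
  exact (summable_zeta_terms hδ_pos w).hasSum

theorem hasSum_kernelT_lattice (hδ : δ = ω₂ / ω₁) (hδ_pos : 0 < δ.im) (z : ℂ) :
    HasSum (fun mn : ℤ × ℤ ↦ discreteLaplacian γ (fun w ↦ 1 / (w - normLattice δ mn)) z)
      (2 * ω₁ * kernelT ω₁ ω₂ γ z) := by
  have hzero : HasSum
      ((fun mn : ℤ × ℤ ↦ discreteLaplacian γ (fun w ↦ 1 / (w - normLattice δ mn)) z)
      ∘ ((↑) : ({0} : Set (ℤ × ℤ)) → ℤ × ℤ)) (discreteLaplacian γ (fun w ↦ 1 / w) z) := by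
    convert hasSum_unique (β := ({0} : Set (ℤ × ℤ))) _ using 1
    simp [normLattice]
  have hne := ((hasSum_weierstrassZeta hδ hδ_pos (z - γ)).sub
    ((hasSum_weierstrassZeta hδ hδ_pos z).mul_left 2)).add
    (hasSum_weierstrassZeta hδ hδ_pos (z + γ))
  have hvalue : 2 * ω₁ * weierstrassZeta ω₁ ω₂ (2 * ω₁ * (z - γ)) - 1 / (z - γ) -
      2 * (2 * ω₁ * weierstrassZeta ω₁ ω₂ (2 * ω₁ * z) - 1 / z) +
      (2 * ω₁ * weierstrassZeta ω₁ ω₂ (2 * ω₁ * (z + γ)) - 1 / (z + γ)) =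
      2 * ω₁ * kernelT ω₁ ω₂ γ z - discreteLaplacian γ (fun w ↦ 1 / w) z := by
    simp only [kernelT, discreteLaplacian]
    ring
  rw [hvalue] at hne
  rw [← add_sub_cancel (discreteLaplacian γ (fun w ↦ 1 / w) z) (2 * ω₁ * kernelT ω₁ ω₂ γ z)]
  refine hzero.hasSum_compl_iff.mp (HasSum.congr_fun hne fun mn ↦ ?_)
  simp only [Function.comp_apply, discreteLaplacian]
  ring

theorem sub_mul_ne_intCast {z : ℂ} (hzδ : |z.im| < δ.im) (hz : ∀ m : ℤ, z ≠ m) (n m : ℤ) :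
    z - n * δ ≠ m := fun h ↦ by
  have him : z.im = n * δ.im := by simpa [sub_eq_zero] using congrArg Complex.im h
  have hδ : 0 < δ.im := (abs_nonneg _).trans_lt hzδ
  rw [him, abs_mul, abs_of_pos hδ, mul_lt_iff_lt_one_left hδ] at hzδ
  have hn : n = 0 := Int.abs_lt_one_iff.mp (by exact_mod_cast hzδ)
  exact hz m (by simpa [hn] using h)

theorem hasSum_kernelT_rows (hδ : δ = ω₂ / ω₁) (hγ : 0 < γ.im) (hγδ : γ.im < δ.im) {s : ℝ}
    (hs : ∀ n : ℤ, s ≠ n) :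
    HasSum (fun n : ℤ ↦ discreteLaplacian γ cotPi (s - n * δ)) (2 * ω₁ * kernelT ω₁ ω₂ γ s) := by
  have hδ_pos := hγ.trans hγδ
  have hlattice := (Equiv.prodComm ℤ ℤ).hasSum_iff.mpr
    (hasSum_kernelT_lattice (γ := γ) hδ hδ_pos s)
  have hshift (n m : ℤ) : discreteLaplacian γ (fun w ↦ 1 / (w - m)) (s - n * δ) =
      discreteLaplacian γ (fun w ↦ 1 / (w - normLattice δ (m, n))) s := by
    simp only [discreteLaplacian, normLattice]
    ring_nf
  have hsub (m : ℤ) : (s : ℂ) - γ ≠ m := fun h ↦ hγ.ne' (by simpa using congrArg Complex.im h)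
  have hadd (m : ℤ) : (s : ℂ) + γ ≠ m := fun h ↦ hγ.ne' (by simpa using congrArg Complex.im h)
  refine hlattice.prod_fiberwise fun n ↦ ?_
  refine (hasSum_discreteLaplacian_cotPi (fun m ↦ ?_) (fun m ↦ ?_) (fun m ↦ ?_) ?_).congr_fun
    fun m ↦ (hshift n m).symm
  · exact sub_mul_ne_intCast (by simpa using hδ_pos) (by exact_mod_cast hs) n m
  · rw [sub_right_comm]
    exact sub_mul_ne_intCast (by simpa [abs_of_pos hγ] using hγδ) hsub n m
  · rw [sub_add_eq_add_sub]
    exact sub_mul_ne_intCast (by simpa [abs_of_pos hγ] using hγδ) hadd n m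
  · exact (hlattice.summable.prod_factor n).congr fun m ↦ (hshift n m).symm

theorem hasSum_kernelT (hδ : δ = ω₂ / ω₁) (hγ : 0 < γ.im) (hγδ : γ.im < δ.im) {s : ℝ}
    (hs : ∀ n : ℤ, s ≠ n) :
    HasSum (fun n : ℕ ↦ discreteLaplacian γ cotPi (s + (n + 1) * δ) -
      discreteLaplacian γ cotPi ((-s : ℝ) + (n + 1) * δ))
      (2 * ω₁ * kernelT ω₁ ω₂ γ s - discreteLaplacian γ cotPi s) := by
  have hrows := hasSum_kernelT_rows hδ hγ hγδ hs
  have hpairs := (hasSum_int_iff_hasSum_pairs (b := 2 * ω₁ * kernelT ω₁ ω₂ γ s -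
    discreteLaplacian γ cotPi s) hrows.summable).mp (by simpa using hrows)
  refine hpairs.congr_fun fun n ↦ ?_
  have hodd := discreteLaplacian_cotPi_neg γ (s - (n + 1) * δ)
  rw [neg_sub, sub_eq_neg_add] at hodd
  push_cast
  rw [hodd]
  ring_nf

end Lattice

/-! ### The Fourier coefficients of the kernel -/

section Coefficients

variable {δ γ : ℂ}

theorem structureConst_neg (hδ : 0 < δ.im) (n : ℤ) :
    structureConst δ γ (-n) = -structureConst δ γ n := by
  rcases eq_or_ne n 0 with rfl | hn
  · simp [structureConst]
  have hp := one_sub_zpow_ne_zero (norm_exp_two_pi_I_mul_lt_one hδ) hn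
  have hp' := one_sub_zpow_ne_zero (norm_exp_two_pi_I_mul_lt_one hδ) (neg_ne_zero.mpr hn)
  unfold structureConst
  rw [← neg_div, div_eq_div_iff hp' hp]
  have hP := zpow_ne_zero n (exp_ne_zero (2 * Real.pi * I * δ))
  have hQ := zpow_ne_zero n (exp_ne_zero (2 * Real.pi * I * γ))
  simp only [neg_neg, zpow_neg]
  field_simp
  ring

@[simp] theorem structureConst_zero (δ γ : ℂ) : structureConst δ γ 0 = 0 := by
  simp [structureConst]

theorem one_sub_structureConst (hδ : 0 < δ.im) (k : ℕ) :
    1 - structureConst δ γ (k + 1) =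
      (𝐞(δ - γ) ^ (k + 1) - 2 * 𝐞(δ) ^ (k + 1) + 𝐞(γ) ^ (k + 1)) / (1 - 𝐞(δ) ^ (k + 1)) := by
  have hp := one_sub_ne_zero_of_norm_lt_one
    (norm_pow_succ_lt_one (norm_exp_two_pi_I_mul_lt_one hδ) k)
  have hq := pow_ne_zero (k + 1) (exp_ne_zero (2 * Real.pi * I * γ))
  simp only [structureConst, ← Nat.cast_succ, Nat.succ_eq_add_one, zpow_neg, zpow_natCast,
    mul_sub _ δ γ, Complex.exp_sub, div_pow]
  generalize 𝐞(δ) ^ (k + 1) = p at *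
  generalize 𝐞(γ) ^ (k + 1) = q at *
  field_simp
  ring

theorem cotPi_add_pi_mul_I {z : ℂ} (hz : 0 < z.im) :
    cotPi z + Real.pi * I = -(2 * Real.pi * I) * (𝐞(z) / (1 - 𝐞(z))) := by
  have hlt := norm_exp_two_pi_I_mul_lt_one hz
  have h := pi_mul_cot_pi_q_exp ⟨z, hz⟩
  rw [UpperHalfPlane.coe_mk, tsum_geometric_of_norm_lt_one hlt] at h
  have hne := one_sub_ne_zero_of_norm_lt_one hlt
  rw [cotPi, h]
  generalize 𝐞(z) = e at *
  field_simp
  ring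

theorem exists_hasSum_cotPi_rows (hδ : 0 < δ.im) {w : ℂ} (hw : 0 < w.im) :
    ∃ L, HasSum (fun n : ℕ ↦ cotPi (w + n * δ) + Real.pi * I) L ∧
      HasSum (fun k : ℕ ↦ -(2 * Real.pi * I) * (𝐞(w) ^ (k + 1) / (1 - 𝐞(δ) ^ (k + 1)))) L := by
  obtain ⟨L, hrows, hcols⟩ := exists_hasSum_lambert (norm_exp_two_pi_I_mul_lt_one hw)
    (norm_exp_two_pi_I_mul_lt_one hδ)
  refine ⟨_, (hrows.mul_left (-(2 * Real.pi * I))).congr_fun fun n ↦ ?_, hcols.mul_left _⟩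
  have hexp : 𝐞(w + n * δ) = 𝐞(w) * 𝐞(δ) ^ n := by
    rw [← Complex.exp_nat_mul, ← Complex.exp_add]
    ring_nf
  have him : 0 < (w + n * δ).im := by
    simp only [add_im, mul_im, natCast_re, natCast_im, zero_mul, add_zero]
    positivity
  rw [cotPi_add_pi_mul_I him, hexp]

theorem exp_two_pi_I_mul_ofReal_add_pow (s : ℝ) (z : ℂ) (k : ℕ) :
    𝐞(s + z) ^ (k + 1) = 𝐞(z) ^ (k + 1) * mode (k + 1) s := by
  rw [add_comm, ← zpow_natCast, exp_two_pi_I_mul_add_ofReal_zpow]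
  norm_cast

theorem exists_hasSum_half_kernel (hγ : 0 < γ.im) (hγδ : γ.im < δ.im) (s : ℝ) :
    ∃ b : ℂ, HasSum (fun n : ℕ ↦ discreteLaplacian γ cotPi (s + (n + 1) * δ)) b ∧
      HasSum (fun k : ℕ ↦ (1 - structureConst δ γ (k + 1)) * mode (k + 1) s)
        (I / (2 * Real.pi) * (b + cotPi (s + γ)) - 1 / 2) := by
  have hδ := hγ.trans hγδ
  obtain ⟨L₁, hrow₁, hcol₁⟩ := exists_hasSum_cotPi_rows hδ (w := s + (δ - γ)) (by simpa using hγδ)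
  obtain ⟨L₂, hrow₂, hcol₂⟩ := exists_hasSum_cotPi_rows hδ (w := s + δ) (by simpa using hδ)
  obtain ⟨L₃, hrow₃, hcol₃⟩ := exists_hasSum_cotPi_rows hδ (w := s + γ) (by simpa using hγ)
  have hpi : (Real.pi : ℂ) ≠ 0 := by exact_mod_cast Real.pi_ne_zero
  have hcols := ((hcol₁.sub (hcol₂.mul_left 2)).add hcol₃).mul_left (I / (2 * Real.pi))
  have hvalue : I / (2 * Real.pi) * (L₁ - 2 * L₂ + L₃) = I / (2 * Real.pi) *
      (L₁ - 2 * L₂ + (L₃ - (cotPi (s + γ) + Real.pi * I)) + cotPi (s + γ)) - 1 / 2 := by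
    field_simp
    linear_combination (Real.pi : ℂ) * I_sq
  refine ⟨_, ((hrow₁.sub (hrow₂.mul_left 2)).add
    ((hasSum_nat_add_iff' 1).mpr hrow₃)).congr_fun fun n ↦ ?_, ?_⟩
  · rw [discreteLaplacian]
    push_cast
    ring_nf
  · simp only [Finset.sum_range_one, Nat.cast_zero, zero_mul, add_zero]
    rw [← hvalue]
    refine hcols.congr_fun fun k ↦ ?_
    rw [one_sub_structureConst hδ, exp_two_pi_I_mul_ofReal_add_pow,
      exp_two_pi_I_mul_ofReal_add_pow, exp_two_pi_I_mul_ofReal_add_pow]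
    field_simp
    rw [I_sq]
    ring

theorem hasFourier_of_odd {a : ℤ → ℂ} {B : ℝ → ℂ} (hodd : ∀ k, a (-k) = -a k)
    (hB : ∀ s, HasSum (fun k : ℕ ↦ a (k + 1) * mode (k + 1) s) (B s)) :
    HasFourier (fun s ↦ B s - B (-s)) a := by
  have hzero : a 0 = 0 := CharZero.eq_neg_self_iff.mp (by simpa using hodd 0)
  have hsum : Summable fun k : ℕ ↦ a (k + 1) := by simpa using (hB 0).summable
  refine ⟨.of_add_one_of_neg_add_one hsum (hsum.neg.congr fun k ↦ (hodd _).symm), fun s ↦ ?_⟩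
  have hneg : HasSum (fun k : ℕ ↦ a (-(k + 1)) * mode (-(k + 1)) s) (-B (-s)) :=
    (hB (-s)).neg.congr_fun fun k ↦ by rw [mode_neg_right, hodd, neg_mul]
  simpa [hzero, sub_eq_add_neg] using
    HasSum.of_add_one_of_neg_add_one (f := fun k ↦ a k * mode k s) (hB s) hneg

theorem exists_kernelT_eq {ω₁ ω₂ : ℂ} (hδ : δ = ω₂ / ω₁) (hγ : 0 < γ.im) (hγδ : γ.im < δ.im) :
    ∃ R : ℝ → ℂ, HasFourier R (fun k ↦ (k.sign : ℂ) - structureConst δ γ k) ∧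
      ∀ s : ℝ, (∀ n : ℤ, s ≠ n) →
        I * ω₁ / Real.pi * kernelT ω₁ ω₂ γ s = -I * cot (Real.pi * s) + R s := by
  choose b hb hB using exists_hasSum_half_kernel hγ hγδ
  have hsign (k : ℕ) : ((k : ℤ) + 1).sign = 1 := Int.sign_eq_one_of_pos (by lia)
  refine ⟨_, hasFourier_of_odd (a := fun k ↦ (k.sign : ℂ) - structureConst δ γ k)
    (fun k ↦ ?_) (by simpa [hsign] using hB), fun s hs ↦ ?_⟩
  · simp only [Int.sign_neg, structureConst_neg (hγ.trans hγδ), Int.cast_neg]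
    ring
  have hkernel := (hasSum_kernelT hδ hγ hγδ hs).unique ((hb s).sub (hb (-s)))
  have hlaplacian : discreteLaplacian γ cotPi s =
      cotPi (s + γ) - cotPi ((-s : ℝ) + γ) - 2 * cotPi s := by
    rw [discreteLaplacian, show (s : ℂ) - γ = -((-s : ℝ) + γ) by push_cast; ring, cotPi_neg]
    ring
  have hpi : (Real.pi : ℂ) ≠ 0 := by exact_mod_cast Real.pi_ne_zero
  have hcot : cot (Real.pi * s) = cotPi s / Real.pi := by
    rw [cotPi]
    field_simp
  rw [hlaplacian] at hkernel
  rw [hcot]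
  linear_combination (I / (2 * Real.pi)) * hkernel

end Coefficients

/-! ### The conjugate function of a character -/

section Cotangent

theorem sin_pi_mul_ne_zero {s : ℝ} (h0 : s ≠ 0) (h1 : |s| < 1) : Real.sin (Real.pi * s) ≠ 0 := by
  have hπ := Real.pi_pos
  rw [abs_lt] at h1
  rw [ne_eq, Real.sin_eq_zero_iff_of_lt_of_lt (by nlinarith) (by nlinarith)]
  simp [hπ.ne', h0]

theorem hasDerivAt_cot_pi_mul {s : ℝ} (h0 : s ≠ 0) (h1 : |s| < 1) :
    HasDerivAt (fun s ↦ Real.cot (Real.pi * s)) (-(Real.pi / Real.sin (Real.pi * s) ^ 2)) s := by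
  have hsin := sin_pi_mul_ne_zero h0 h1
  have hmul : HasDerivAt (fun s ↦ Real.pi * s) Real.pi s := by
    simpa using (hasDerivAt_id s).const_mul Real.pi
  simp only [Real.cot_eq_cos_div_sin]
  refine (hmul.cos.div hmul.sin hsin).congr_deriv ?_
  field_simp
  linear_combination -Real.sin_sq_add_cos_sq (Real.pi * s)

theorem continuousOn_cot_pi_mul :
    ContinuousOn (fun s ↦ Real.cot (Real.pi * s)) {s | s ≠ 0 ∧ |s| < 1} :=
  fun _ hs ↦ (hasDerivAt_cot_pi_mul hs.1 hs.2).continuousAt.continuousWithinAt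

theorem uIcc_subset_ne_zero_abs_lt_one {a b : ℝ} (ha : 0 < a) (hab : a ≤ b) (hb : b ≤ 1 / 2) :
    Set.uIcc a b ⊆ {s : ℝ | s ≠ 0 ∧ |s| < 1} := fun s hs ↦ by
  rw [Set.uIcc_of_le hab] at hs
  have hs0 : 0 < s := ha.trans_le hs.1
  exact ⟨hs0.ne', by rw [abs_of_pos hs0]; linarith [hs.2]⟩

theorem intervalIntegrable_cot_mul {a b : ℝ} (ha : 0 < a) (hab : a ≤ b) (hb : b ≤ 1 / 2)
    {g : ℝ → ℝ} (hg : Continuous g) :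
    IntervalIntegrable (fun s ↦ Real.cot (Real.pi * s) * g s) volume a b :=
  ((continuousOn_cot_pi_mul.mono (uIcc_subset_ne_zero_abs_lt_one ha hab hb)).mul
    hg.continuousOn).intervalIntegrable

theorem cot_pi_mul_nonneg {s : ℝ} (h0 : 0 ≤ s) (h1 : s ≤ 1 / 2) : 0 ≤ Real.cot (Real.pi * s) := by
  have hπ := Real.pi_pos
  rw [Real.cot_eq_cos_div_sin]
  exact div_nonneg (Real.cos_nonneg_of_neg_pi_div_two_le_of_le (by nlinarith) (by nlinarith))
    (Real.sin_nonneg_of_nonneg_of_le_pi (by positivity) (by nlinarith))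

theorem cot_pi_mul_le {s : ℝ} (h0 : 0 < s) (h1 : s ≤ 1 / 2) :
    Real.cot (Real.pi * s) ≤ 1 / (Real.pi * s) := by
  have hπ := Real.pi_pos
  have hπs : 0 < Real.pi * s := by positivity
  rw [← inv_inv (Real.cot _), Real.cot_inv_eq_tan, ← one_div]
  rcases h1.lt_or_eq with h | rfl
  · exact one_div_le_one_div_of_le hπs (Real.le_tan hπs.le (by nlinarith))
  · rw [mul_one_div, Real.tan_pi_div_two, div_zero]
    positivity

end Cotangent

section SecondMeanValue

theorem integral_mul_le_of_deriv_nonpos {a b M : ℝ} {g g' F f : ℝ → ℝ} (hab : a ≤ b)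
    (hg : ∀ s ∈ Set.Icc a b, HasDerivAt g (g' s) s) (hg' : ∀ s ∈ Set.Icc a b, g' s ≤ 0)
    (hgb : g b = 0) (hF : ∀ s ∈ Set.Icc a b, HasDerivAt F (f s) s)
    (hFM : ∀ s ∈ Set.Icc a b, |F s| ≤ M) (hf : ContinuousOn f (Set.Icc a b)) :
    ∫ s in a..b, g s * f s ≤ 2 * M * g a := by
  have hderiv : ∀ s ∈ Set.Icc a b,
      HasDerivAt (fun s ↦ g s * (F s - M)) (g' s * (F s - M) + g s * f s) s :=
    fun s hs ↦ (hg s hs).mul ((hF s hs).sub_const M)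
  have hga : 0 ≤ g a := hgb.symm.le.trans <| antitoneOn_of_deriv_nonpos (convex_Icc a b)
    (fun s hs ↦ (hg s hs).continuousAt.continuousWithinAt)
    (fun s hs ↦ (hg s (interior_subset hs)).differentiableAt.differentiableWithinAt)
    (fun s hs ↦ (hg s (interior_subset hs)).deriv ▸ hg' s (interior_subset hs))
    (Set.left_mem_Icc.mpr hab) (Set.right_mem_Icc.mpr hab) hab
  have hle := intervalIntegral.integral_le_sub_of_hasDeriv_right_of_le hab
    (fun s hs ↦ (hderiv s hs).continuousAt.continuousWithinAt)
    (fun s hs ↦ (hderiv s (Set.Ioo_subset_Icc_self hs)).hasDerivWithinAt)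
    ((ContinuousOn.mul (fun s hs ↦ (hg s hs).continuousAt.continuousWithinAt)
      hf).integrableOn_Icc)
    fun s hs ↦ le_add_of_nonneg_left (mul_nonneg_of_nonpos_of_nonpos
      (hg' s (Set.Ioo_subset_Icc_self hs))
      (sub_nonpos.mpr ((abs_le.mp (hFM s (Set.Ioo_subset_Icc_self hs))).2)))
  have hFa := (abs_le.mp (hFM a (Set.left_mem_Icc.mpr hab))).1
  simp only [Pi.mul_apply, hgb, zero_mul, zero_sub] at hle
  nlinarith

theorem abs_integral_mul_le_of_deriv_nonpos {a b M : ℝ} {g g' F f : ℝ → ℝ} (hab : a ≤ b)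
    (hg : ∀ s ∈ Set.Icc a b, HasDerivAt g (g' s) s) (hg' : ∀ s ∈ Set.Icc a b, g' s ≤ 0)
    (hgb : g b = 0) (hF : ∀ s ∈ Set.Icc a b, HasDerivAt F (f s) s)
    (hFM : ∀ s ∈ Set.Icc a b, |F s| ≤ M) (hf : ContinuousOn f (Set.Icc a b)) :
    |∫ s in a..b, g s * f s| ≤ 2 * M * g a := by
  have hneg := integral_mul_le_of_deriv_nonpos hab hg hg' hgb (F := fun s ↦ -F s)
    (fun s hs ↦ (hF s hs).neg) (by simpa using hFM) hf.neg
  simp only [mul_neg, intervalIntegral.integral_neg] at hneg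
  exact abs_le'.mpr ⟨integral_mul_le_of_deriv_nonpos hab hg hg' hgb hF hFM hf, hneg⟩

end SecondMeanValue

/-- The truncated conjugate function `∫_r^{1/2} cot(πs) sin(2πks) ds` of a sine, at the origin. -/
def cotSinIntegral (k : ℤ) (r : ℝ) : ℝ :=
  ∫ s in r..(1 / 2), Real.cot (Real.pi * s) * Real.sin (2 * Real.pi * k * s)

@[simp] theorem cotSinIntegral_zero (r : ℝ) : cotSinIntegral 0 r = 0 := by
  simp [cotSinIntegral]

theorem cotSinIntegral_neg (k : ℤ) (r : ℝ) : cotSinIntegral (-k) r = -cotSinIntegral k r := by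
  simp [cotSinIntegral]

theorem cotSinIntegral_succ_sub (k : ℤ) {r : ℝ} (hr : 0 < r) (hr' : r < 1 / 2) :
    cotSinIntegral (k + 1) r - cotSinIntegral k r =
      ∫ s in r..(1 / 2), (Real.cos (2 * Real.pi * (k + 1 : ℤ) * s) +
        Real.cos (2 * Real.pi * k * s)) := by
  rw [cotSinIntegral, cotSinIntegral, ← intervalIntegral.integral_sub
    (intervalIntegrable_cot_mul hr hr'.le le_rfl (by fun_prop))
    (intervalIntegrable_cot_mul hr hr'.le le_rfl (by fun_prop))]
  refine intervalIntegral.integral_congr fun s hs ↦ ?_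
  have hs' := uIcc_subset_ne_zero_abs_lt_one hr hr'.le le_rfl hs
  have hsin := sin_pi_mul_ne_zero hs'.1 hs'.2
  simp only [Real.cot_eq_cos_div_sin]
  rw [show 2 * Real.pi * ((k + 1 : ℤ) : ℝ) * s = 2 * Real.pi * k * s + 2 * (Real.pi * s) by
    push_cast; ring, Real.sin_add, Real.cos_add, Real.sin_two_mul, Real.cos_two_mul]
  have hsq := Real.sin_sq_add_cos_sq (Real.pi * s)
  generalize Real.pi * s = u at *
  generalize 2 * Real.pi * (k : ℝ) * s = v
  field_simp
  linear_combination (2 * Real.sin v * Real.cos u) * hsq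

theorem integral_cos_two_pi_mul_half (k : ℤ) :
    ∫ s in (0 : ℝ)..(1 / 2), Real.cos (2 * Real.pi * k * s) = if k = 0 then 1 / 2 else 0 := by
  split_ifs with hk
  · simp [hk]
  · have hc : 2 * Real.pi * k ≠ 0 := by simp [hk, Real.pi_ne_zero]
    rw [intervalIntegral.integral_comp_mul_left Real.cos hc, integral_cos,
      show 2 * Real.pi * (k : ℝ) * (1 / 2) = k * Real.pi by ring, Real.sin_int_mul_pi]
    simp

theorem tendsto_integral_left {E : Type*} [NormedAddCommGroup E] [NormedSpace ℝ E]
    {g : ℝ → E} (hg : Continuous g) (a b : ℝ) :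
    Tendsto (fun r ↦ ∫ s in r..b, g s) (𝓝[>] a) (𝓝 (∫ s in a..b, g s)) := by
  have h : Continuous fun r ↦ ∫ s in r..b, g s := by
    simp only [intervalIntegral.integral_symm b]
    exact (intervalIntegral.continuous_primitive (fun _ _ ↦ hg.intervalIntegrable _ _) b).neg
  exact (h.tendsto a).mono_left nhdsWithin_le_nhds

theorem eventually_mem_Ioo_half : ∀ᶠ r : ℝ in 𝓝[>] 0, r ∈ Set.Ioo 0 (1 / 2) :=
  Ioo_mem_nhdsGT (by norm_num)

theorem tendsto_cotSinIntegral_natCast (n : ℕ) :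
    Tendsto (cotSinIntegral n) (𝓝[>] 0) (𝓝 (((n : ℤ).sign : ℝ) / 2)) := by
  induction n with
  | zero =>
    rw [Nat.cast_zero, show cotSinIntegral 0 = fun _ ↦ 0 from funext cotSinIntegral_zero]
    simp
  | succ n ih =>
    have hstep := tendsto_integral_left (g := fun s ↦ Real.cos (2 * Real.pi * (n + 1 : ℤ) * s) +
      Real.cos (2 * Real.pi * (n : ℤ) * s)) (by fun_prop) 0 (1 / 2)
    rw [intervalIntegral.integral_add (Continuous.intervalIntegrable (by fun_prop) _ _)
      (Continuous.intervalIntegrable (by fun_prop) _ _), integral_cos_two_pi_mul_half,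
      integral_cos_two_pi_mul_half, if_neg (by lia)] at hstep
    have hlim : ((n : ℤ).sign : ℝ) / 2 + (0 + if (n : ℤ) = 0 then 1 / 2 else 0) =
        (((n + 1 : ℕ) : ℤ).sign : ℝ) / 2 := by
      rw [Int.sign_eq_one_of_pos (a := ((n + 1 : ℕ) : ℤ)) (by lia)]
      rcases n.eq_zero_or_pos with rfl | hn
      · simp
      · rw [Int.sign_eq_one_of_pos (by lia), if_neg (by lia)]
        simp
    refine hlim ▸ (ih.add hstep).congr' ?_
    filter_upwards [eventually_mem_Ioo_half] with r hr
    rw [← cotSinIntegral_succ_sub _ hr.1 hr.2, add_sub_cancel, Nat.cast_succ]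

theorem tendsto_cotSinIntegral (k : ℤ) :
    Tendsto (cotSinIntegral k) (𝓝[>] 0) (𝓝 ((k.sign : ℝ) / 2)) := by
  rcases k.eq_nat_or_neg with ⟨n, rfl | rfl⟩
  · exact tendsto_cotSinIntegral_natCast n
  · rw [show cotSinIntegral (-n) = fun r ↦ -cotSinIntegral n r from
      funext (cotSinIntegral_neg n), Int.sign_neg, Int.cast_neg, neg_div]
    exact (tendsto_cotSinIntegral_natCast n).neg

theorem abs_integral_cot_mul_sin_le_of_le {n : ℕ} (hn : 0 < n) {a b : ℝ} (ha : 0 < a)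
    (hab : a ≤ b) (hb : b ≤ 1 / 2) :
    |∫ s in a..b, Real.cot (Real.pi * s) * Real.sin (2 * Real.pi * n * s)| ≤ 2 * n * (b - a) := by
  rw [← Real.norm_eq_abs, ← abs_of_nonneg (sub_nonneg.mpr hab)]
  refine intervalIntegral.norm_integral_le_of_norm_le_const fun s hs ↦ ?_
  rw [Set.uIoc_of_le hab] at hs
  have hs0 : 0 < s := ha.trans hs.1
  have hsin : |Real.sin (2 * Real.pi * n * s)| ≤ 2 * Real.pi * n * s := by
    have h := Real.abs_sin_le_abs (x := 2 * Real.pi * n * s)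
    rwa [abs_of_pos (a := 2 * Real.pi * n * s) (by positivity)] at h
  rw [norm_mul, Real.norm_eq_abs, Real.norm_eq_abs,
    abs_of_nonneg (cot_pi_mul_nonneg hs0.le (hs.2.trans hb))]
  calc _ ≤ 1 / (Real.pi * s) * (2 * Real.pi * n * s) :=
        mul_le_mul (cot_pi_mul_le hs0 (hs.2.trans hb)) hsin (abs_nonneg _) (by positivity)
    _ = 2 * n := by field_simp

theorem abs_integral_cot_mul_sin_half_le {n : ℕ} (hn : 0 < n) {a : ℝ} (ha : 0 < a)
    (ha' : a ≤ 1 / 2) :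
    |∫ s in a..(1 / 2), Real.cot (Real.pi * s) * Real.sin (2 * Real.pi * n * s)| ≤
      1 / (Real.pi * n) * (1 / (Real.pi * a)) := by
  have hprim (s : ℝ) : HasDerivAt (fun s ↦ -Real.cos (2 * Real.pi * n * s) / (2 * Real.pi * n))
      (Real.sin (2 * Real.pi * n * s)) s := by
    have hmul : HasDerivAt (fun s ↦ 2 * Real.pi * n * s) (2 * Real.pi * n) s := by
      simpa using (hasDerivAt_id s).const_mul (2 * Real.pi * n)
    refine (hmul.cos.neg.div_const (2 * Real.pi * n)).congr_deriv ?_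
    field_simp
  have hle := abs_integral_mul_le_of_deriv_nonpos ha' (M := 1 / (2 * Real.pi * n))
    (fun s hs ↦ have hs' := uIcc_subset_ne_zero_abs_lt_one ha ha' le_rfl (Set.Icc_subset_uIcc hs)
      hasDerivAt_cot_pi_mul hs'.1 hs'.2)
    (fun s _ ↦ neg_nonpos.mpr (by positivity))
    (by simp [Real.cot_eq_cos_div_sin, ← div_eq_mul_inv])
    (fun s _ ↦ hprim s) (fun s _ ↦ ?_) (by fun_prop)
  · refine hle.trans ?_
    rw [show 2 * (1 / (2 * Real.pi * n)) = 1 / (Real.pi * n) by field_simp]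
    gcongr
    exact cot_pi_mul_le ha ha'
  · rw [abs_div, abs_neg, abs_of_pos (a := 2 * Real.pi * n) (by positivity)]
    gcongr
    exact Real.abs_cos_le_one _

theorem abs_cotSinIntegral_natCast_le {n : ℕ} (hn : 0 < n) {r : ℝ} (hr : 0 < r)
    (hr' : r < 1 / 2) : |cotSinIntegral n r| ≤ 2 := by
  have hn' : (1 : ℝ) ≤ n := by exact_mod_cast hn
  -- At scale `1 / n` the sine starts to oscillate, and the cotangent is no longer large.
  set a : ℝ := max r (1 / (2 * n)) with ha
  have hra : r ≤ a := le_max_left _ _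
  have ha' : a ≤ 1 / 2 := max_le hr'.le (one_div_le_one_div_of_le (by norm_num) (by linarith))
  have hna : 1 / 2 ≤ n * a := by
    calc (1 / 2 : ℝ) = n * (1 / (2 * n)) := by field_simp
      _ ≤ n * a := by gcongr; exact le_max_right _ _
  have hnear := abs_integral_cot_mul_sin_le_of_le hn hr hra ha'
  have hfar := abs_integral_cot_mul_sin_half_le hn (hr.trans_le hra) ha'
  have hnear' : 2 * n * (a - r) ≤ 1 := by
    rcases max_cases r (1 / (2 * n : ℝ)) with ⟨h, -⟩ | ⟨h, -⟩
    · rw [ha, h, sub_self, mul_zero]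
      exact zero_le_one
    · calc 2 * n * (a - r) ≤ 2 * n * a := by gcongr; linarith
        _ = 1 := by rw [ha, h]; field_simp
  have hfar' : 1 / (Real.pi * n) * (1 / (Real.pi * a)) ≤ 1 := by
    rw [one_div_mul_one_div, div_le_one (by positivity)]
    calc (1 : ℝ) ≤ 3 * 3 * (1 / 2) := by norm_num
      _ ≤ Real.pi * Real.pi * (n * a) := by gcongr <;> exact Real.pi_gt_three.le
      _ = Real.pi * n * (Real.pi * a) := by ring
  rw [cotSinIntegral, Int.cast_natCast, ← intervalIntegral.integral_add_adjacent_intervals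
    (intervalIntegrable_cot_mul hr hra ha' (by fun_prop))
    (intervalIntegrable_cot_mul (hr.trans_le hra) ha' le_rfl (by fun_prop))]
  linarith [abs_add_le (∫ s in r..a, Real.cot (Real.pi * s) * Real.sin (2 * Real.pi * n * s))
    (∫ s in a..(1 / 2), Real.cot (Real.pi * s) * Real.sin (2 * Real.pi * n * s))]

theorem abs_cotSinIntegral_le (k : ℤ) {r : ℝ} (hr : 0 < r) (hr' : r < 1 / 2) :
    |cotSinIntegral k r| ≤ 2 := by
  rcases k.eq_nat_or_neg with ⟨n, rfl | rfl⟩ <;> rcases n.eq_zero_or_pos with rfl | hn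
  · simp
  · exact abs_cotSinIntegral_natCast_le hn hr hr'
  · simp
  · rw [cotSinIntegral_neg, abs_neg]
    exact abs_cotSinIntegral_natCast_le hn hr hr'

/-! ### Principal values as Fourier multipliers -/

/-- The interval `(-1/2, 1/2)` without the closed ball of radius `r` around `0`: the domain of the
truncated integrals, seen from the singularity. -/
def puncturedInterval (r : ℝ) : Set ℝ := {s | r < |s| ∧ |s| < 1 / 2}

section PuncturedInterval

variable {E : Type*} [NormedAddCommGroup E] {r : ℝ}

theorem puncturedInterval_eq_union (hr : 0 < r) :
    puncturedInterval r = Set.Ioo (-(1 / 2)) (-r) ∪ Set.Ioo r (1 / 2) := by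
  ext s
  simp only [puncturedInterval, Set.mem_ofPred_eq, Set.mem_union, Set.mem_Ioo, lt_abs, abs_lt]
  grind

theorem Ioo_inter_lt_abs_sub_round (r : ℝ) :
    Set.Ioo (-(1 / 2)) (1 / 2) ∩ {s : ℝ | r < |s - round s|} = puncturedInterval r := by
  ext s
  simp only [Set.mem_inter_iff, ← abs_lt, Set.mem_Ioo, Set.mem_ofPred_eq, puncturedInterval,
    and_comm (b := |s| < 1 / 2)]
  refine and_congr_right fun hs ↦ ?_
  rw [abs_lt] at hs
  rw [round_eq_zero_iff.mpr ⟨by linarith, hs.2⟩, Int.cast_zero, sub_zero]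

theorem measurableSet_lt_abs_sub_round (r : ℝ) : MeasurableSet {s : ℝ | r < |s - round s|} := by
  have hround : Measurable fun s : ℝ ↦ ((round s : ℤ) : ℝ) := by
    simp only [round_eq]
    exact measurable_from_top.comp (Int.measurable_floor.comp (measurable_id.add_const _))
  exact measurableSet_lt measurable_const
    (continuous_abs.measurable.comp (measurable_id'.sub hround))

theorem integrableOn_puncturedInterval_of_continuousOn {g : ℝ → E}
    (hg : ContinuousOn g {s | s ≠ 0 ∧ |s| < 1}) (hr : 0 < r) :
    IntegrableOn g (puncturedInterval r) := by
  have hcompact : IsCompact (Set.Icc (-(1 / 2)) (1 / 2) ∩ {s : ℝ | r ≤ |s|}) :=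
    isCompact_Icc.inter_right (isClosed_le continuous_const continuous_abs)
  refine ((hg.mono fun s hs ↦ ?_).integrableOn_compact hcompact).mono_set fun s hs ↦
    ⟨Set.Ioo_subset_Icc_self (abs_lt.mp hs.2), hs.1.le⟩
  exact ⟨abs_pos.mp (hr.trans_le hs.2), (abs_le.mpr hs.1).trans_lt (by norm_num)⟩

variable [NormedSpace ℝ E]

theorem setIntegral_puncturedInterval {g : ℝ → E} (hr : 0 < r) (hr' : r < 1 / 2)
    (hg : IntegrableOn g (puncturedInterval r)) :
    ∫ s in puncturedInterval r, g s = ∫ s in r..(1 / 2), (g s + g (-s)) := by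
  rw [puncturedInterval_eq_union hr] at hg ⊢
  have hright : IntervalIntegrable g volume r (1 / 2) :=
    (intervalIntegrable_iff_integrableOn_Ioo_of_le hr'.le).mpr hg.right_of_union
  have hleft : IntervalIntegrable g volume (-(1 / 2)) (-r) :=
    (intervalIntegrable_iff_integrableOn_Ioo_of_le (by linarith)).mpr hg.left_of_union
  have hleft' : IntervalIntegrable (fun s ↦ g (-s)) volume r (1 / 2) := by
    simpa using ((IntervalIntegrable.iff_comp_neg (f := g)).mp hleft).symm
  rw [setIntegral_union (Set.disjoint_left.mpr fun s hs hs' ↦ by linarith [hs.2, hs'.1])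
      measurableSet_Ioo hg.left_of_union hg.right_of_union,
    ← integral_Ioc_eq_integral_Ioo, ← integral_Ioc_eq_integral_Ioo,
    ← intervalIntegral.integral_of_le (by linarith), ← intervalIntegral.integral_of_le hr'.le,
    intervalIntegral.integral_add hright hleft', intervalIntegral.integral_comp_neg, add_comm]

theorem setIntegral_Icc_inter_preimage_sub {g : ℝ → E} (hg : Function.Periodic g 1) {A : Set ℝ}
    (hA : MeasurableSet A) (hA' : ∀ s, s + 1 ∈ A ↔ s ∈ A) (x : ℝ) :
    ∫ y in Set.Icc (-1 / 2) (1 / 2) ∩ (fun y ↦ y - x) ⁻¹' A, g (y - x) =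
      ∫ s in Set.Ioo (-(1 / 2)) (1 / 2) ∩ A, g s := by
  have hper : Function.Periodic (A.indicator g) 1 := fun s ↦ by
    by_cases hs : s ∈ A
    · rw [Set.indicator_of_mem ((hA' s).mpr hs), Set.indicator_of_mem hs, hg]
    · rw [Set.indicator_of_notMem (mt (hA' s).mp hs), Set.indicator_of_notMem hs]
  have hpre : MeasurableSet ((fun y ↦ y - x) ⁻¹' A) := (measurable_id'.sub_const x) hA
  rw [← setIntegral_indicator hpre, ← setIntegral_indicator hA,
    integral_Icc_eq_integral_Ioc, ← integral_Ioc_eq_integral_Ioo,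
    ← intervalIntegral.integral_of_le (by norm_num),
    ← intervalIntegral.integral_of_le (by norm_num)]
  calc ∫ y in (-1 / 2 : ℝ)..(1 / 2), ((fun y ↦ y - x) ⁻¹' A).indicator (fun y ↦ g (y - x)) y
      = ∫ y in (-1 / 2 : ℝ)..(1 / 2), A.indicator g (y - x) := rfl
    _ = ∫ s in (-1 / 2 - x)..(-1 / 2 - x + 1), A.indicator g s := by
      rw [intervalIntegral.integral_comp_sub_right]
      ring_nf
    _ = ∫ s in (-(1 / 2))..(-(1 / 2) + 1), A.indicator g s := hper.intervalIntegral_add_eq _ _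
    _ = ∫ s in (-(1 / 2))..(1 / 2), A.indicator g s := by norm_num

end PuncturedInterval

/-- A principal-value kernel: a multiple of the cotangent plus a regular part `R`. -/
def pvKernel (R : ℝ → ℂ) (s : ℝ) : ℂ := -I * Real.cot (Real.pi * s) + R s

/-- The integral of the kernel against a character, away from the singularity. -/
def truncatedMultiplier (R : ℝ → ℂ) (k : ℤ) (r : ℝ) : ℂ :=
  ∫ s in puncturedInterval r, pvKernel R s * mode k s

section Multiplier

variable {R : ℝ → ℂ} {b : ℤ → ℂ} {r : ℝ}

theorem pvKernel_periodic (hR : Function.Periodic R 1) : Function.Periodic (pvKernel R) 1 :=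
  fun s ↦ by
    simp only [pvKernel]
    rw [hR s, mul_add, mul_one, Real.cot_eq_cos_div_sin, Real.cot_eq_cos_div_sin, Real.sin_add_pi,
      Real.cos_add_pi, neg_div_neg_eq]

theorem continuousOn_ofReal_cot_pi_mul :
    ContinuousOn (fun s ↦ (Real.cot (Real.pi * s) : ℂ)) {s | s ≠ 0 ∧ |s| < 1} :=
  continuous_ofReal.comp_continuousOn continuousOn_cot_pi_mul

theorem integrableOn_pvKernel_mul (hR : Continuous R) (hr : 0 < r) {g : ℝ → ℂ}
    (hg : Continuous g) : IntegrableOn (fun s ↦ pvKernel R s * g s) (puncturedInterval r) :=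
  integrableOn_puncturedInterval_of_continuousOn (((continuousOn_const.mul
    continuousOn_ofReal_cot_pi_mul).add hR.continuousOn).mul hg.continuousOn) hr

theorem integrableOn_cot_mul_mode (k : ℤ) (hr : 0 < r) :
    IntegrableOn (fun s ↦ -I * Real.cot (Real.pi * s) * mode k s) (puncturedInterval r) :=
  integrableOn_puncturedInterval_of_continuousOn
    ((continuousOn_const.mul continuousOn_ofReal_cot_pi_mul).mul
      (continuous_mode k).continuousOn) hr

theorem setIntegral_cot_mul_mode (k : ℤ) (hr : 0 < r) (hr' : r < 1 / 2) :
    ∫ s in puncturedInterval r, -I * Real.cot (Real.pi * s) * mode k s =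
      2 * cotSinIntegral k r := by
  rw [setIntegral_puncturedInterval hr hr' (integrableOn_cot_mul_mode k hr),
    cotSinIntegral, ← intervalIntegral.integral_ofReal, ← intervalIntegral.integral_const_mul]
  refine intervalIntegral.integral_congr fun s _ ↦ ?_
  have hsin : (Real.sin (2 * Real.pi * k * s) : ℂ) = (mode (-k) s - mode k s) * I / 2 := by
    rw [ofReal_sin, Complex.sin, mode, mode]
    push_cast
    ring_nf
  have hcot : Real.cot (Real.pi * -s) = -Real.cot (Real.pi * s) := by
    simp [Real.cot_eq_cos_div_sin, div_neg]
  simp only [hcot, mode_neg_right, ofReal_mul, hsin, ofReal_neg]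
  ring

theorem truncatedMultiplier_eq (hR : Continuous R) (k : ℤ) (hr : 0 < r) (hr' : r < 1 / 2) :
    truncatedMultiplier R k r =
      2 * cotSinIntegral k r + ∫ s in r..(1 / 2), (R s * mode k s + R (-s) * mode k (-s)) := by
  have hregular : IntegrableOn (fun s ↦ R s * mode k s) (puncturedInterval r) :=
    integrableOn_puncturedInterval_of_continuousOn (hR.mul (continuous_mode k)).continuousOn hr
  rw [← setIntegral_cot_mul_mode k hr hr', ← setIntegral_puncturedInterval hr hr' hregular,
    ← integral_add (integrableOn_cot_mul_mode k hr) hregular, truncatedMultiplier]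
  simp only [pvKernel, add_mul]

theorem norm_truncatedMultiplier_le (hR : HasFourier R b) (k : ℤ) (hr : 0 < r) (hr' : r < 1 / 2) :
    ‖truncatedMultiplier R k r‖ ≤ 4 + ∑' k, ‖b k‖ := by
  have hregular : ‖∫ s in r..(1 / 2), (R s * mode k s + R (-s) * mode k (-s))‖ ≤
      (∑' k, ‖b k‖ + ∑' k, ‖b k‖) * |1 / 2 - r| :=
    intervalIntegral.norm_integral_le_of_norm_le_const fun s _ ↦ by
      refine (norm_add_le _ _).trans ?_
      rw [norm_mul, norm_mul, norm_mode, norm_mode, mul_one, mul_one]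
      exact add_le_add (hR.norm_le s) (hR.norm_le (-s))
  have hnonneg : 0 ≤ ∑' k, ‖b k‖ := tsum_nonneg fun _ ↦ norm_nonneg _
  rw [abs_of_pos (by linarith)] at hregular
  rw [truncatedMultiplier_eq hR.continuous k hr hr']
  refine (norm_add_le _ _).trans ?_
  rw [norm_mul, norm_real, Real.norm_eq_abs, norm_ofNat]
  nlinarith [abs_cotSinIntegral_le k hr hr']

theorem tendsto_truncatedMultiplier (hR : HasFourier R b) (k : ℤ) :
    Tendsto (truncatedMultiplier R k) (𝓝[>] 0) (𝓝 (k.sign + b (-k))) := by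
  have hRc := hR.continuous
  have hcont : Continuous fun s ↦ R s * mode k s := hRc.mul (continuous_mode k)
  have hcont_neg : Continuous fun s ↦ R (-s) * mode k (-s) := hcont.comp continuous_neg
  have hregular := tendsto_integral_left
    (g := fun s ↦ R s * mode k s + R (-s) * mode k (-s)) (by fun_prop) 0 (1 / 2)
  have hcoeff : ∫ s in (0 : ℝ)..(1 / 2), (R s * mode k s + R (-s) * mode k (-s)) = b (-k) := by
    rw [← hR.integral_mul_mode k, intervalIntegral.integral_add (hcont.intervalIntegrable _ _)
      (hcont_neg.intervalIntegrable _ _),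
      intervalIntegral.integral_comp_neg (fun s ↦ R s * mode k s), add_comm, neg_zero,
      ← neg_div, intervalIntegral.integral_add_adjacent_intervals
        (hcont.intervalIntegrable _ _) (hcont.intervalIntegrable _ _)]
  have hcot := ((continuous_ofReal.tendsto _).comp (tendsto_cotSinIntegral k)).const_mul 2
  have hsign : (2 : ℂ) * (((k.sign : ℝ) / 2 : ℝ) : ℂ) = k.sign := by
    push_cast
    ring
  rw [hcoeff] at hregular
  rw [hsign] at hcot
  refine (hcot.add hregular).congr' ?_
  filter_upwards [eventually_mem_Ioo_half] with r hr
  exact (truncatedMultiplier_eq hRc k hr.1 hr.2).symm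

theorem hasSum_setIntegral_pvKernel_mul (hR : Continuous R) {f : ℝ → ℂ} {a : ℤ → ℂ}
    (hf : HasFourier f a) (x : ℝ) (hr : 0 < r) :
    HasSum (fun k ↦ a k * mode k x * truncatedMultiplier R k r)
      (∫ s in puncturedInterval r, pvKernel R s * f (s + x)) := by
  have hint (k : ℤ) := integrableOn_pvKernel_mul hR hr (continuous_mode k)
  have hsum := hasSum_integral_of_summable_integral_norm
    (F := fun k s ↦ a k * mode k x * (pvKernel R s * mode k s))
    (fun k ↦ (hint k).const_mul _) (by
      simp only [norm_mul, norm_mode, mul_one, integral_const_mul]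
      exact hf.summable.norm.mul_right _)
  simp only [integral_const_mul] at hsum
  have hexpand : (fun s ↦ pvKernel R s * f (s + x)) =
      fun s ↦ ∑' k, a k * mode k x * (pvKernel R s * mode k s) := funext fun s ↦ by
    rw [← (hf.hasSum _).tsum_eq, ← tsum_mul_left]
    refine tsum_congr fun k ↦ ?_
    rw [mode_add_right]
    ring
  rw [hexpand]
  exact hsum

end Multiplier

section OperatorT

variable {ω₁ ω₂ δ γ : ℂ} {f : ℝ → ℂ} {a : ℤ → ℂ}

theorem truncatedT_eq {R : ℝ → ℂ} (hRp : Function.Periodic R 1)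
    (hR : ∀ s : ℝ, (∀ n : ℤ, s ≠ n) →
      I * ω₁ / Real.pi * kernelT ω₁ ω₂ γ s = -I * cot (Real.pi * s) + R s)
    (hf : Function.Periodic f 1) (x : ℝ) {r : ℝ} (hr : 0 ≤ r) :
    truncatedT ω₁ ω₂ γ f x r = ∫ s in puncturedInterval r, pvKernel R s * f (s + x) := by
  have hmeas := measurableSet_lt_abs_sub_round r
  have hper : Function.Periodic (fun s ↦ pvKernel R s * f (s + x)) 1 := fun s ↦ by
    simp only
    rw [pvKernel_periodic hRp, add_right_comm, hf]
  rw [← Ioo_inter_lt_abs_sub_round, ← setIntegral_Icc_inter_preimage_sub hper hmeas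
    (fun s ↦ by simp [round_add_one]) x, truncatedT, ← integral_const_mul]
  refine setIntegral_congr_fun (measurableSet_Icc.inter ((measurable_id'.sub_const x) hmeas))
    fun y hy ↦ ?_
  have hne (n : ℤ) : y - x ≠ n := fun hn ↦ by
    have hlt : r < |(y - x) - round (y - x)| := hy.2
    rw [hn, round_intCast, sub_self, abs_zero] at hlt
    linarith
  simp only [sub_add_cancel]
  rw [← mul_assoc, hR _ hne, pvKernel, ofReal_cot, ofReal_mul]

theorem exists_norm_structureConst_le (hγ : 0 < γ.im) (hγδ : γ.im < δ.im) :
    ∃ C, ∀ k, ‖structureConst δ γ k‖ ≤ C := by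
  obtain ⟨R, hR, -⟩ := exists_kernelT_eq (ω₁ := 1) (div_one δ).symm hγ hγδ
  refine ⟨1 + ∑' k : ℤ, ‖(k.sign : ℂ) - structureConst δ γ k‖, fun k ↦ ?_⟩
  have hsign : ‖(k.sign : ℂ)‖ ≤ 1 := by
    rcases k.sign_trichotomy with h | h | h <;> simp [h]
  have hle : ‖(k.sign : ℂ) - structureConst δ γ k‖ ≤ _ :=
    hR.summable.norm.le_tsum k fun _ _ ↦ norm_nonneg _
  have hsub := norm_sub_norm_le (structureConst δ γ k) (k.sign : ℂ)
  rw [norm_sub_rev] at hsub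
  linarith

theorem summable_structureConst_mul (hγ : 0 < γ.im) (hγδ : γ.im < δ.im) (ha : Summable a) :
    Summable fun k ↦ structureConst δ γ k * a k := by
  obtain ⟨C, hC⟩ := exists_norm_structureConst_le hγ hγδ
  refine .of_norm_bounded (ha.norm.mul_left C) fun k ↦ ?_
  rw [norm_mul]
  gcongr
  exact hC k

theorem tendsto_truncatedT (hδ : δ = ω₂ / ω₁) (hγ : 0 < γ.im) (hγδ : γ.im < δ.im)
    (hf : HasFourier f a) (x : ℝ) :
    Tendsto (fun r ↦ truncatedT ω₁ ω₂ γ f x r) (𝓝[>] 0)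
      (𝓝 (∑' k, structureConst δ γ k * a k * mode k x)) := by
  obtain ⟨R, hR, hkernel⟩ := exists_kernelT_eq hδ hγ hγδ
  have hlim (k : ℤ) : Tendsto (fun r ↦ a k * mode k x * truncatedMultiplier R k r) (𝓝[>] 0)
      (𝓝 (structureConst δ γ k * a k * mode k x)) := by
    convert (tendsto_truncatedMultiplier hR k).const_mul (a k * mode k x) using 2
    rw [structureConst_neg (hγ.trans hγδ), Int.sign_neg]
    push_cast
    ring
  have htsum := tendsto_tsum_of_dominated_convergence
    (hf.summable.norm.mul_right (4 + ∑' k : ℤ, ‖(k.sign : ℂ) - structureConst δ γ k‖)) hlim (by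
      filter_upwards [eventually_mem_Ioo_half] with r hr k
      rw [norm_mul, norm_mul, norm_mode, mul_one]
      gcongr
      exact norm_truncatedMultiplier_le hR k hr.1 hr.2)
  refine htsum.congr' ?_
  filter_upwards [eventually_mem_Ioo_half] with r hr
  rw [truncatedT_eq hR.periodic hkernel hf.periodic x hr.1.le]
  exact (hasSum_setIntegral_pvKernel_mul hR.continuous hf x hr.1).tsum_eq

end OperatorT

/-! ### Differentiation on the phase space -/

section PhaseLift

variable {E : Type*} [NormedAddCommGroup E] [NormedSpace ℂ E] {φ : Mode → E} {C : ℝ}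

theorem hasSum_norm_phase (lam : Phase) : HasSum (fun m : Mode ↦ ‖lam m‖) ‖lam‖ := by
  simpa using lp.hasSum_norm (p := 1) (by simp) lam

theorem norm_phase_smul_le (hφ : ∀ m, ‖φ m‖ ≤ C) (lam : Phase) (m : Mode) :
    ‖lam m • φ m‖ ≤ ‖lam m‖ * C := by
  rw [norm_smul]
  exact mul_le_mul_of_nonneg_left (hφ m) (norm_nonneg _)

variable [CompleteSpace E]

theorem summable_phase_smul (hφ : ∀ m, ‖φ m‖ ≤ C) (lam : Phase) :
    Summable fun m ↦ lam m • φ m :=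
  .of_norm_bounded ((hasSum_norm_phase lam).summable.mul_right C) (norm_phase_smul_le hφ lam)

/-- The continuous linear map `λ ↦ ∑ λ_m φ_m` on the phase space attached to a bounded family `φ`:
the universal property of `ℓ¹`. -/
def phaseLift (φ : Mode → E) (C : ℝ) (hφ : ∀ m, ‖φ m‖ ≤ C) : Phase →L[ℂ] E :=
  LinearMap.mkContinuous
    { toFun := fun lam ↦ ∑' m, lam m • φ m
      map_add' := fun lam mu ↦ by
        simp only [lp.coeFn_add, Pi.add_apply, add_smul]
        exact (summable_phase_smul hφ lam).tsum_add (summable_phase_smul hφ mu)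
      map_smul' := fun c lam ↦ by
        simp only [lp.coeFn_smul, Pi.smul_apply, smul_assoc, RingHom.id_apply]
        exact (summable_phase_smul hφ lam).tsum_const_smul c }
    C fun lam ↦ by
      rw [mul_comm]
      exact tsum_of_norm_bounded ((hasSum_norm_phase lam).mul_right C)
        (norm_phase_smul_le hφ lam)

theorem hasSum_phaseLift (hφ : ∀ m, ‖φ m‖ ≤ C) (lam : Phase) :
    HasSum (fun m ↦ lam m • φ m) (phaseLift φ C hφ lam) :=
  (summable_phase_smul hφ lam).hasSum

theorem phaseLift_single (hφ : ∀ m, ‖φ m‖ ≤ C) (k : Mode) :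
    phaseLift φ C hφ (lp.single 1 k (1 : ℂ)) = φ k := by
  have hsingle := hasSum_single (f := fun m ↦ (lp.single 1 k (1 : ℂ) : Phase) m • φ m) k
    fun m hm ↦ by rw [lp.single_apply_ne _ _ _ hm, zero_smul]
  rw [(hasSum_phaseLift hφ _).unique hsingle, lp.single_apply_self, one_smul]

end PhaseLift

/-- The exponent of `η(x)` as a linear functional of `λ`. -/
def etaExponent (x : ℝ) : Phase →L[ℂ] ℂ :=
  phaseLift (fun m ↦ mode (-m) x) 1 fun _ ↦ (norm_mode _ x).le

theorem hasSum_etaExponent (lam : Phase) (x : ℝ) :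
    HasSum (fun m : Mode ↦ lam m * mode (-m) x) (etaExponent x lam) :=
  hasSum_phaseLift _ lam

theorem etaExponent_single (k : Mode) (x : ℝ) :
    etaExponent x (lp.single 1 k (1 : ℂ)) = mode (-k) x :=
  phaseLift_single _ k

theorem eta_eq (ε : ℂ) (lam : Phase) (x : ℝ) : eta ε lam x = ε * exp (etaExponent x lam) := by
  rw [eta, ← (hasSum_etaExponent lam x).tsum_eq]
  simp [mode]

theorem hasFDerivAt_eta (ε : ℂ) (lam : Phase) (x : ℝ) :
    HasFDerivAt (fun l ↦ eta ε l x) (eta ε lam x • etaExponent x) lam := by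
  simp only [eta_eq]
  refine (((etaExponent x).hasFDerivAt.cexp).const_mul ε).congr_fderiv ?_
  rw [smul_smul]

theorem partialD_eta (ε : ℂ) (lam : Phase) (x : ℝ) (m : Mode) :
    partialD m (fun l ↦ eta ε l x) lam = eta ε lam x * mode (-m) x := by
  rw [partialD, (hasFDerivAt_eta ε lam x).fderiv, smul_apply, etaExponent_single, smul_eq_mul]

theorem exists_hasFourier_etaExponent (lam : Phase) :
    ∃ a, HasFourier (fun x ↦ etaExponent x lam) a :=
  exists_hasFourier_of_hasSum (fun m : Mode ↦ -(m : ℤ)) (fun m ↦ lam m)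
    (hasSum_norm_phase lam).summable (hasSum_etaExponent lam)

/-! ### The derivative of the Hamiltonians -/

section Integrand

variable {δ γ ε : ℂ} {n : ℕ}

/-- The common integrand `K_n(x₁, …, x_n) η(x₁) ⋯ η(x_n)` of `I_n` and `H_n`. -/
def integrand (δ γ ε : ℂ) (lam : Phase) (x : Fin n → ℝ) : ℂ :=
  pairKernel δ γ x * ∏ i, eta ε lam (x i)

theorem inWiener_integrand (hγ : 0 < γ.im) (hγδ : γ.im < δ.im) (lam : Phase) :
    InWiener (integrand δ γ ε lam : (Fin n → ℝ) → ℂ) := by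
  obtain ⟨a, ha⟩ := exists_hasFourier_etaExponent lam
  refine (inWiener_pairKernel hγ hγδ n).mul ?_
  simp only [eta_eq]
  exact .prod _ fun i _ ↦ .mul (.const ε) (ha.inWiener_comp_apply i).exp

theorem integrand_comp_perm (lam : Phase) (σ : Equiv.Perm (Fin n)) (x : Fin n → ℝ) :
    integrand δ γ ε lam (fun i ↦ x (σ i)) = integrand δ γ ε lam x := by
  simp only [integrand, pairKernel_comp_perm]
  rw [Equiv.prod_comp σ fun i ↦ eta ε lam (x i)]

end Integrand

open scoped BoundedContinuousFunction

/-- The sum of the values of a character at the coordinates, as a bounded continuous function. -/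
def modeSum (n : ℕ) (k : ℤ) : (Fin n → ℝ) →ᵇ ℂ :=
  .ofNormedAddCommGroup (fun x ↦ ∑ i, mode k (x i)) (by fun_prop) n
    fun x ↦ (norm_sum_le _ _).trans (by simp)

theorem norm_modeSum_le (n : ℕ) (k : ℤ) : ‖modeSum n k‖ ≤ n :=
  BoundedContinuousFunction.norm_ofNormedAddCommGroup_le _ (Nat.cast_nonneg n) _

/-- The exponent of `η(x₁) ⋯ η(x_n)`, as a continuous linear map of `λ` with values in the bounded
continuous functions of `x`. -/
def totalExponent (n : ℕ) : Phase →L[ℂ] ((Fin n → ℝ) →ᵇ ℂ) :=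
  phaseLift (fun m ↦ modeSum n (-m)) n fun _ ↦ norm_modeSum_le _ _

theorem totalExponent_apply (n : ℕ) (lam : Phase) (x : Fin n → ℝ) :
    totalExponent n lam x = ∑ i, etaExponent (x i) lam := by
  have heval := (BoundedContinuousFunction.evalCLM ℂ x).hasSum
    (hasSum_phaseLift (φ := fun m ↦ modeSum n (-m)) (fun _ ↦ norm_modeSum_le _ _) lam)
  refine heval.unique ((hasSum_sum fun i (_ : i ∈ Finset.univ) ↦
    hasSum_etaExponent lam (x i)).congr_fun fun m ↦ ?_)
  simp [modeSum, Finset.mul_sum]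

theorem exp_boundedContinuousFunction_apply {X : Type*} [TopologicalSpace X] (g : X →ᵇ ℂ) (x : X) :
    NormedSpace.exp g x = exp (g x) := by
  have heval := (BoundedContinuousFunction.evalCLM ℂ x).hasSum
    (NormedSpace.exp_series_hasSum_exp' (𝕂 := ℂ) g)
  rw [Complex.exp_eq_exp_ℂ]
  refine heval.unique ((NormedSpace.exp_series_hasSum_exp' (𝕂 := ℂ) (g x)).congr_fun fun N ↦ ?_)
  simp

theorem prod_eta_eq (ε : ℂ) (lam : Phase) {n : ℕ} (x : Fin n → ℝ) :
    ∏ i, eta ε lam (x i) = ε ^ n * NormedSpace.exp (totalExponent n lam) x := by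
  rw [exp_boundedContinuousFunction_apply, totalExponent_apply, Complex.exp_sum]
  simp [eta_eq, Finset.prod_mul_distrib]

/-- Integration over the cube against a continuous weight, as a continuous linear functional. -/
def cubeFunctional {n : ℕ} (K : (Fin n → ℝ) → ℂ) (hK : Continuous K) :
    ((Fin n → ℝ) →ᵇ ℂ) →L[ℂ] ℂ :=
  have hint (g : (Fin n → ℝ) →ᵇ ℂ) : IntegrableOn (fun x ↦ K x * g x) (cube n) :=
    (hK.mul g.continuous).integrableOn_Icc
  LinearMap.mkContinuous
    { toFun := fun g ↦ ∫ x in cube n, K x * g x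
      map_add' := fun g h ↦ by
        rw [← integral_add (hint g) (hint h)]
        simp [mul_add]
      map_smul' := fun c g ↦ by
        rw [RingHom.id_apply, smul_eq_mul, ← integral_const_mul]
        simp [mul_left_comm] }
    (∫ x in cube n, ‖K x‖) fun g ↦ by
      rw [← integral_mul_const]
      refine norm_integral_le_of_norm_le (hK.norm.integrableOn_Icc.mul_const _) (ae_of_all _ ?_)
      intro x
      rw [norm_mul]
      exact mul_le_mul_of_nonneg_left (g.norm_coe_le_norm x) (norm_nonneg _)

theorem cubeFunctional_apply {n : ℕ} {K : (Fin n → ℝ) → ℂ} (hK : Continuous K)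
    (g : (Fin n → ℝ) →ᵇ ℂ) : cubeFunctional K hK g = ∫ x in cube n, K x * g x := rfl

theorem hasFDerivAt_comp_exp {V A F : Type*} [NormedAddCommGroup V] [NormedSpace ℂ V]
    [NormedCommRing A] [NormedAlgebra ℂ A] [CompleteSpace A] [NormedAddCommGroup F]
    [NormedSpace ℂ F] (T : A →L[ℂ] F) (L : V →L[ℂ] A) (v : V) :
    HasFDerivAt (fun w ↦ T (NormedSpace.exp (L w)))
      (T.comp ((NormedSpace.exp (L v) • (1 : A →L[ℂ] A)).comp L)) v :=
  T.hasFDerivAt.comp v ((hasFDerivAt_exp (𝕂 := ℂ) (x := L v)).comp v L.hasFDerivAt)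

section Hamiltonian

variable {δ γ : ℂ}

theorem hamiltonian_eq (ε : ℂ) {n : ℕ} (hK : Continuous fun x : Fin n → ℝ ↦ pairKernel δ γ x)
    (lam : Phase) :
    hamiltonian δ γ ε n lam = (prefactor δ γ n / n.factorial * ε ^ n) •
      cubeFunctional _ hK (NormedSpace.exp (totalExponent n lam)) := by
  simp only [hamiltonian, prod_eta_eq, cubeFunctional_apply, smul_eq_mul, mul_assoc]
  simp only [mul_left_comm _ (ε ^ n), integral_const_mul]

theorem hasFDerivAt_hamiltonian (ε : ℂ) {n : ℕ}
    (hK : Continuous fun x : Fin n → ℝ ↦ pairKernel δ γ x) (lam : Phase) :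
    HasFDerivAt (hamiltonian δ γ ε n) ((prefactor δ γ n / n.factorial * ε ^ n) •
      (cubeFunctional _ hK).comp ((NormedSpace.exp (totalExponent n lam) •
        (1 : ((Fin n → ℝ) →ᵇ ℂ) →L[ℂ] ((Fin n → ℝ) →ᵇ ℂ))).comp (totalExponent n))) lam := by
  rw [funext (hamiltonian_eq ε hK)]
  exact (hasFDerivAt_comp_exp (cubeFunctional _ hK) (totalExponent n) lam).const_smul
    (prefactor δ γ n / n.factorial * ε ^ n)

theorem differentiable_hamiltonian (hγ : 0 < γ.im) (hγδ : γ.im < δ.im) (ε : ℂ) (n : ℕ) :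
    Differentiable ℂ (hamiltonian δ γ ε n) := fun lam ↦
  (hasFDerivAt_hamiltonian ε (inWiener_pairKernel hγ hγδ n).continuous lam).differentiableAt

theorem fderiv_hamiltonian_apply (hγ : 0 < γ.im) (hγδ : γ.im < δ.im) (ε : ℂ) (n : ℕ)
    (lam v : Phase) :
    fderiv ℂ (hamiltonian δ γ ε n) lam v = prefactor δ γ n / n.factorial *
      ∫ x in cube n, integrand δ γ ε lam x * ∑ i, etaExponent (x i) v := by
  rw [(hasFDerivAt_hamiltonian ε (inWiener_pairKernel hγ hγδ n).continuous lam).fderiv]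
  simp only [smul_apply, ContinuousLinearMap.comp_apply, smul_eq_mul, cubeFunctional_apply,
    one_apply_eq_self, BoundedContinuousFunction.mul_apply, totalExponent_apply]
  rw [mul_assoc, ← integral_const_mul]
  congr 2 with x
  rw [integrand, prod_eta_eq]
  ring

end Hamiltonian

/-! ### Densities and symmetric integrands -/

theorem integral_cube_comp_perm {E : Type*} [NormedAddCommGroup E] [NormedSpace ℝ E] {n : ℕ}
    (σ : Equiv.Perm (Fin n)) (f : (Fin n → ℝ) → E) :
    ∫ x in cube n, f (fun i ↦ x (σ i)) = ∫ x in cube n, f x := by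
  have hpres := volume_preserving_arrowCongr' σ.symm (MeasurableEquiv.refl ℝ) (.id _)
  have hpre : (fun (x : Fin n → ℝ) i ↦ x (σ i)) ⁻¹' cube n = cube n := by
    ext x
    simp only [cube, Set.mem_preimage, Set.mem_Icc, Pi.le_def, σ.forall_congr_right
      (q := fun i ↦ -1 / 2 ≤ x i), σ.forall_congr_right (q := fun i ↦ x i ≤ 1 / 2)]
  have hset := hpres.setIntegral_preimage_emb (MeasurableEquiv.measurableEmbedding _) f (cube n)
  change ∫ x in (fun (x : Fin n → ℝ) i ↦ x (σ i)) ⁻¹' cube n, f (fun i ↦ x (σ i)) = _ at hset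
  rwa [hpre] at hset

theorem integral_cube_mul_sum {m : ℕ} {F : (Fin (m + 1) → ℝ) → ℂ} (hF : Continuous F)
    (hFsymm : ∀ (σ : Equiv.Perm (Fin (m + 1))) x, F (fun i ↦ x (σ i)) = F x) {φ : ℝ → ℂ}
    (hφ : Continuous φ) :
    ∫ x in cube (m + 1), F x * ∑ i, φ (x i) =
      (m + 1 : ℕ) * ∫ x in cube (m + 1), F x * φ (x 0) := by
  have hfirst (i : Fin (m + 1)) :
      ∫ x in cube (m + 1), F x * φ (x i) = ∫ x in cube (m + 1), F x * φ (x 0) := by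
    rw [← integral_cube_comp_perm (Equiv.swap 0 i)]
    simp only [hFsymm, Equiv.swap_apply_right]
  have hint (i : Fin (m + 1)) : IntegrableOn (fun x ↦ F x * φ (x i)) (cube (m + 1)) :=
    Continuous.integrableOn_Icc (by fun_prop)
  simp only [Finset.mul_sum]
  rw [integral_finsetSum _ fun i _ ↦ hint i]
  simp [hfirst]

theorem div_factorial_succ_mul (c : ℂ) (m : ℕ) :
    c / (m + 1).factorial * (m + 1 : ℕ) = c / m.factorial := by
  rw [Nat.factorial_succ, Nat.cast_mul, mul_comm (((m + 1 : ℕ) : ℂ)),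
    div_mul_eq_mul_div, mul_div_mul_right _ _ (Nat.cast_ne_zero.mpr m.succ_ne_zero)]

section Density

variable {δ γ ε : ℂ} {m : ℕ} {lam : Phase} {h : ℤ → ℂ}

theorem density_succ (δ γ ε : ℂ) (m : ℕ) (lam : Phase) (x : ℝ) :
    density δ γ ε (m + 1) lam x = prefactor δ γ (m + 1) / m.factorial *
      ∫ y in cube m, integrand δ γ ε lam (Fin.cons x y : Fin (m + 1) → ℝ) := rfl

theorem density_one (hγ : 0 < γ.im) (hγδ : γ.im < δ.im) (ε : ℂ) (lam : Phase) :
    density δ γ ε 1 lam = eta ε lam := by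
  ext x
  have hkernel (z : Fin 1 → ℝ) : pairKernel δ γ z = 1 := by simp [pairKernel]
  have hvolume : (volume : Measure (Fin 0 → ℝ)).real (cube 0) = 1 := by
    simp [cube, Measure.real, Real.volume_Icc_pi]
  simp [density_succ, integrand, prefactor, hkernel, hvolume, theta1_ne_zero hγ hγδ]

theorem exists_hasFourier_density (hγ : 0 < γ.im) (hγδ : γ.im < δ.im) (ε : ℂ) (m : ℕ)
    (lam : Phase) : ∃ h, HasFourier (density δ γ ε (m + 1) lam) h := by
  obtain ⟨b, hb⟩ := (inWiener_integrand (ε := ε) (n := m + 1) hγ hγδ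
    lam).exists_hasFourier_integral_cons (volume.restrict (cube m))
  exact ⟨_, hb.const_mul (prefactor δ γ (m + 1) / m.factorial)⟩

theorem integral_density_mul (hγ : 0 < γ.im) (hγδ : γ.im < δ.im) (ε : ℂ) (m : ℕ) (lam : Phase)
    {φ : ℝ → ℂ} (hφ : Continuous φ) :
    ∫ x in Set.Icc (-1 / 2 : ℝ) (1 / 2), density δ γ ε (m + 1) lam x * φ x =
      prefactor δ γ (m + 1) / m.factorial *
        ∫ z in cube (m + 1), integrand δ γ ε lam z * φ (z 0) := by
  have hcont : Continuous fun z : Fin (m + 1) → ℝ ↦ integrand δ γ ε lam z * φ (z 0) :=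
    (inWiener_integrand hγ hγδ lam).continuous.mul (by fun_prop)
  rw [integral_cube_succ hcont, ← integral_const_mul]
  simp only [density_succ, Fin.cons_zero, integral_mul_const, mul_assoc]

theorem natCast_mul_hamiltonian (hγ : 0 < γ.im) (hγδ : γ.im < δ.im) (ε : ℂ) (m : ℕ)
    (lam : Phase) : ((m + 1 : ℕ) : ℂ) * hamiltonian δ γ ε (m + 1) lam =
      ∫ x in Set.Icc (-1 / 2 : ℝ) (1 / 2), density δ γ ε (m + 1) lam x := by
  have hone := integral_density_mul hγ hγδ ε m lam (φ := fun _ ↦ 1) continuous_const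
  simp only [mul_one] at hone
  rw [hone, hamiltonian, ← mul_assoc, mul_comm ((m + 1 : ℕ) : ℂ), div_factorial_succ_mul]
  rfl

theorem partialD_hamiltonian (hγ : 0 < γ.im) (hγδ : γ.im < δ.im)
    (hh : HasFourier (density δ γ ε (m + 1) lam) h) (k : Mode) :
    partialD k (hamiltonian δ γ ε (m + 1)) lam = h k := by
  have hcoeff := hh.integral_mul_mode (-k)
  rw [neg_neg, intervalIntegral.integral_of_le (by norm_num), ← integral_Icc_eq_integral_Ioc,
    integral_density_mul hγ hγδ ε m lam (continuous_mode _)] at hcoeff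
  simp only [partialD, fderiv_hamiltonian_apply hγ hγδ, etaExponent_single]
  rw [integral_cube_mul_sum (inWiener_integrand hγ hγδ lam).continuous (integrand_comp_perm lam)
    (continuous_mode _), ← mul_assoc, div_factorial_succ_mul, hcoeff]

/-! ### The bracket and the flow -/

theorem hasSum_bracketTerm (hγ : 0 < γ.im) (hγδ : γ.im < δ.im)
    (hh : HasFourier (density δ γ ε (m + 1) lam) h) (x : ℝ) :
    HasSum (bracketTerm δ γ (hamiltonian δ γ ε (m + 1)) (fun l ↦ eta ε l x) lam)
      (eta ε lam x * ∑' k, structureConst δ γ k * h k * mode k x) := by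
  have hsummable : Summable fun k : ℤ ↦ structureConst δ γ k * h k * mode k x := by
    refine .of_norm ?_
    simpa using (summable_structureConst_mul hγ hγδ hh.summable).norm
  have hmodes : HasSum (fun k : Mode ↦ structureConst δ γ k * h k * mode k x)
      (∑' k : ℤ, structureConst δ γ k * h k * mode k x) := by
    refine (hasSum_subtype_iff_of_support_subset
      (f := fun k : ℤ ↦ structureConst δ γ k * h k * mode k x)
      (s := {k : ℤ | k ≠ 0}) fun k hk ↦ ?_).mpr hsummable.hasSum
    rintro rfl
    simp at hk
  refine (hmodes.mul_left (eta ε lam x)).congr_fun fun k ↦ ?_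
  rw [bracketTerm, partialD_eta, partialD_hamiltonian hγ hγδ hh, Mode.opp, neg_neg]
  ring

theorem Mode.opp_involutive : Function.Involutive Mode.opp := fun _ ↦ Subtype.ext (neg_neg _)

theorem bracketConverges_hamiltonian_eta (hγ : 0 < γ.im) (hγδ : γ.im < δ.im) (ε : ℂ) (m : ℕ)
    (lam : Phase) (x : ℝ) :
    BracketConverges δ γ (hamiltonian δ γ ε (m + 1)) (fun l ↦ eta ε l x) lam :=
  let ⟨_, hh⟩ := exists_hasFourier_density hγ hγδ ε m lam
  (hasSum_bracketTerm hγ hγδ hh x).summable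

theorem convergesT_density {ω₁ ω₂ : ℂ} (hδ : δ = ω₂ / ω₁) (hγ : 0 < γ.im) (hγδ : γ.im < δ.im)
    (ε : ℂ) (m : ℕ) (lam : Phase) (x : ℝ) :
    ConvergesT ω₁ ω₂ γ (density δ γ ε (m + 1) lam) x :=
  let ⟨_, hh⟩ := exists_hasFourier_density hγ hγδ ε m lam
  ⟨_, tendsto_truncatedT hδ hγ hγδ hh x⟩

theorem bracket_hamiltonian_eta {ω₁ ω₂ : ℂ} (hδ : δ = ω₂ / ω₁) (hγ : 0 < γ.im)
    (hγδ : γ.im < δ.im) (ε : ℂ) (m : ℕ) (lam : Phase) (x : ℝ) :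
    bracket δ γ (hamiltonian δ γ ε (m + 1)) (fun l ↦ eta ε l x) lam =
      eta ε lam x * operatorT ω₁ ω₂ γ (density δ γ ε (m + 1) lam) x := by
  obtain ⟨h, hh⟩ := exists_hasFourier_density hγ hγδ ε m lam
  rw [bracket, (hasSum_bracketTerm hγ hγδ hh x).tsum_eq, operatorT,
    (tendsto_truncatedT hδ hγ hγδ hh x).limUnder_eq]

theorem bracket_coord_right (F : Phase → ℂ) (lam : Phase) (k : Mode) :
    bracket δ γ F (coord k) lam = structureConst δ γ k.opp * partialD k.opp F lam := by
  rw [bracket, tsum_eq_single k.opp fun j hj ↦ ?_]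
  · simp [bracketTerm, partialD_coord, Mode.opp_involutive k]
  · have hne : j.opp ≠ k := fun hk ↦ hj (Mode.opp_involutive.eq_iff.mp hk)
    simp [bracketTerm, partialD_coord, hne]

theorem IsHamiltonianFlowAt.hasDerivAt_eta {F : Phase → ℂ} {Λ : ℝ → Phase} {t : ℝ}
    (hΛ : IsHamiltonianFlowAt δ γ F Λ t) (ε : ℂ) (x : ℝ) :
    HasDerivAt (fun s ↦ eta ε (Λ s) x) (bracket δ γ F (fun l ↦ eta ε l x) (Λ t)) t := by
  obtain ⟨v, hv, hvk⟩ := hΛ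
  have hderiv := ((hasFDerivAt_eta ε (Λ t) x).restrictScalars ℝ).comp_hasDerivAt t hv
  suffices hbracket : bracket δ γ F (fun l ↦ eta ε l x) (Λ t) =
      eta ε (Λ t) x * etaExponent x v from hbracket ▸ hderiv
  rw [bracket, ← (hasSum_etaExponent v x).tsum_eq, ← tsum_mul_left,
    ← Equiv.tsum_eq Mode.opp_involutive.toPerm]
  refine tsum_congr fun k ↦ ?_
  rw [Function.Involutive.coe_toPerm, hvk, bracket_coord_right, bracketTerm, partialD_eta,
    Mode.opp_involutive k]
  ring

theorem IsHamiltonianFlowAt.satisfiesILWAt {ω₁ ω₂ : ℂ} {Λ : ℝ → Phase} {t : ℝ}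
    (hΛ : IsHamiltonianFlowAt δ γ (hamiltonian δ γ ε 1) Λ t) (hδ : δ = ω₂ / ω₁) (hγ : 0 < γ.im)
    (hγδ : γ.im < δ.im) (x : ℝ) :
    SatisfiesILWAt ω₁ ω₂ γ (fun y s ↦ eta ε (Λ s) y) x t := by
  have hconv := convergesT_density hδ hγ hγδ ε 0 (Λ t) x
  have hbracket := bracket_hamiltonian_eta hδ hγ hγδ ε 0 (Λ t) x
  rw [zero_add, density_one hγ hγδ] at hconv hbracket
  exact ⟨hconv, hbracket ▸ hΛ.hasDerivAt_eta ε x⟩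

end Density

end EllipticILW

end

theorem mainTheorem4 (ω₁ ω₂ δ γ ε : ℂ) (hδ : δ = ω₂ / ω₁)
    (hδ_pos : 0 < δ.im) (hγ_pos : 0 < γ.im) (hγ_lt : γ.im < δ.im) :
    (∀ n : ℕ, 1 ≤ n →
      -- `n I_n = ∫ H_n`
      (∀ lam : Phase,
        (n : ℂ) * hamiltonian δ γ ε n lam =
          ∫ x in Set.Icc (-1 / 2 : ℝ) (1 / 2), density δ γ ε n lam x) ∧
      -- `{I_n, η(x)} = η(x) 𝖳(H_n)(x)`, everything being well defined
      Differentiable ℂ (hamiltonian δ γ ε n) ∧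
      (∀ x : ℝ, Differentiable ℂ (fun lam : Phase => eta ε lam x)) ∧
      (∀ (lam : Phase) (x : ℝ),
        BracketConverges δ γ (hamiltonian δ γ ε n) (fun l => eta ε l x) lam ∧
        ConvergesT ω₁ ω₂ γ (density δ γ ε n lam) x ∧
        bracket δ γ (hamiltonian δ γ ε n) (fun l => eta ε l x) lam =
          eta ε lam x * operatorT ω₁ ω₂ γ (density δ γ ε n lam) x) ∧
      -- `∂η/∂t_n = {I_n, η(x)} = η(x) 𝖳(H_n)(x)` along the Hamiltonian flow of `I_n`
      (∀ (Λ : ℝ → Phase) (t : ℝ), IsHamiltonianFlowAt δ γ (hamiltonian δ γ ε n) Λ t →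
        ∀ x : ℝ,
          HasDerivAt (fun s => eta ε (Λ s) x)
            (bracket δ γ (hamiltonian δ γ ε n) (fun l => eta ε l x) (Λ t)) t ∧
          HasDerivAt (fun s => eta ε (Λ s) x)
            (eta ε (Λ t) x * operatorT ω₁ ω₂ γ (density δ γ ε n (Λ t)) x) t)) ∧
    -- the case `n = 1` is the integro-differential equation
    (∀ (lam : Phase) (x : ℝ), density δ γ ε 1 lam x = eta ε lam x) ∧
    (∀ (Λ : ℝ → Phase) (t : ℝ), IsHamiltonianFlowAt δ γ (hamiltonian δ γ ε 1) Λ t →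
      ∀ x : ℝ, SatisfiesILWAt ω₁ ω₂ γ (fun y s => eta ε (Λ s) y) x t) := by
  refine ⟨fun n hn ↦ ?_, fun lam x ↦ congrFun (density_one hγ_pos hγ_lt ε lam) x,
    fun Λ t hΛ x ↦ hΛ.satisfiesILWAt hδ hγ_pos hγ_lt x⟩
  obtain ⟨m, rfl⟩ := Nat.exists_eq_add_of_le' hn
  have hbracket := bracket_hamiltonian_eta hδ hγ_pos hγ_lt ε m
  refine ⟨natCast_mul_hamiltonian hγ_pos hγ_lt ε m, differentiable_hamiltonian hγ_pos hγ_lt ε _,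
    fun x lam ↦ (hasFDerivAt_eta ε lam x).differentiableAt, fun lam x ↦ ⟨?_, ?_, hbracket lam x⟩,
    fun Λ t hΛ x ↦ ?_⟩
  · exact bracketConverges_hamiltonian_eta hγ_pos hγ_lt ε m lam x
  · exact convergesT_density hδ hγ_pos hγ_lt ε m lam x
  · have hflow := hΛ.hasDerivAt_eta ε x
    exact ⟨hflow, hbracket (Λ t) x ▸ hflow⟩
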